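/- Let $T$ be a complete first-order theory in a language $L$ and let $\mathfrak{C}$ be a monster model of $T$, that is, for some cardinal $\kappa>|T|=|L|+\aleph_0$, $\mathfrak{C}\models T$ is $\kappa$-saturated and every partial elementary map $A\to\mathfrak{C}$ with $A\subseteq\mathfrak{C}$, $|A|<\kappa$, extends to an automorphism of $\mathfrak{C}$. Sets and models of size $<\kappa$ are called small. Below $x,y$ denote finite tuples of variables, formulas $\varphi(x,y)$ are $L$-formulas without parameters, and $n$ is the length of $x$. For a structure $M$ and a complete type $p(x)$ over $M$, let $M_p$ be the expansion of $M$ by a relation symbol $d_px\,\varphi(x,y)$ for every formula $\varphi(x,y)$, interpreted as $\{b : \varphi(x,b)\in p\}$; for $A\subseteq M^n$ let $(M_p,A)$ be the further expansion by an $n$-ary predicate interpreted as $A$. The type $p$ is finitely satisfiable in $A\subseteq M^n$ if for every $\varphi(x,b)\in p$ there is $a\in A$ such that $\varphi(a,b)$ holds. An sp-example for $T$ is a tuple $(M,p,\varphi(x,y),A_1,A_2)$ such that $M\models T$; $A_1,A_2\subseteq M^n$ are nonempty and disjoint; $p(x)$ is a complete type over $M$ that is finitely satisfiable in $A_1$;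 $\mathrm{Th}(M_p,A_1)=\mathrm{Th}(M_p,A_2)$; and for all finite $s_1\subseteq A_1$, $s_2\subseteq A_2$, $$M\models\exists y\Big(\bigwedge_{a\in s_1}\varphi(a,y)\wedge\bigwedge_{b\in s_2}\neg\varphi(b,y)\Big).$$ A complete type $p$ over $\mathfrak{C}$ (a global type) splinters over an elementary substructure $M\prec\mathfrak{C}$ if there is an automorphism $\sigma$ of $\mathfrak{C}$ such that $\sigma(M)=M$ setwise, $\sigma(p|_M)=p|_M$ and $\sigma(p)\neq p$. It splits over $M$ if there are a formula $\varphi(x,y)$ and tuples $b,c$ from $\mathfrak{C}$ with the same type over $M$ such that $\varphi(x,b)\in p$ and $\varphi(x,c)\notin p$. Then $T$ has an sp-example if and only if there are a small model $M\prec\mathfrak{C}$ and a global type $p(x)$ that is finitely satisfiable in $M$ (that is, in $M^n$) and splinters over $M$. In particular, if $T$ has an sp-example, then there are a small model $M\prec\mathfrak{C}$ and a global type that splinters over $M$ but does not split over $M$. -/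

import Mathlib

open FirstOrder

universe u v w

namespace FirstOrder.Language

section Types

variable (L : Language.{u, v})

/-- `S_n(M)`: the complete types in the variables `x₀, …, xₙ₋₁` over (all elements of) the
structure `M`, i.e. the maximal sets of formulas with parameters from `M` that are consistent
with the elementary diagram of `M`. For `M` the monster model these are the global types. -/
abbrev TypeOver (M : Type w) [L.Structure M] (n : ℕ) : Type (max u v w) :=
  (L.elementaryDiagram M).CompleteType (Fin n)

variable {L}

/-- The formula `φ(x, b)` with parameters in `M`, where `φ(x, y)` is an `L`-formula and the tuple
`b` from `M` is substituted for `y`. -/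
def formulaAt {M : Type w} {n m : ℕ} (φ : L.Formula (Fin n ⊕ Fin m)) (b : Fin m → M) :
    L[[M]].Formula (Fin n) :=
  BoundedFormula.subst ((L.lhomWithConstants M).onFormula φ)
    (Sum.elim (fun i => Term.var i) (fun j => (L.con (b j)).term))

/-- Substitution does what it should: `φ(x, b)` holds at `a` iff `φ(a, b)` holds. -/
theorem realize_formulaAt {M : Type w} [L.Structure M] {n m : ℕ}
    (φ : L.Formula (Fin n ⊕ Fin m)) (b : Fin m → M) (a : Fin n → M) :
    (formulaAt φ b).Realize a ↔ φ.Realize (Sum.elim a b) := by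
  unfold formulaAt Formula.Realize
  rw [BoundedFormula.realize_subst]
  have h : (fun k : Fin n ⊕ Fin m => Term.realize a (Sum.elim (fun i => Term.var i)
      (fun j => (L.con (b j)).term) k : L[[M]].Term (Fin n))) = Sum.elim a b := by
    funext k
    rcases k with i | j
    · rfl
    · show Term.realize a (L.con (b j)).term = b j
      rw [Term.realize_constants]
      rfl
  rw [h]
  exact LHom.realize_onFormula (L.lhomWithConstants M) φ

namespace TypeOver

/-- `φ(x, b) ∈ p`. -/
def Has {M : Type w} [L.Structure M] {n m : ℕ} (p : TypeOver L M n)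
    (φ : L.Formula (Fin n ⊕ Fin m)) (b : Fin m → M) : Prop :=
  Formula.equivSentence (formulaAt φ b) ∈ p

/-- For an elementary map `f : M → N` and `p ∈ S_n(N)`, the type over `M` consisting of the
formulas `φ(x, b)`, `b` from `M`, such that `φ(x, f(b)) ∈ p`. -/
def pullback {M N : Type w} [L.Structure M] [L.Structure N] {n : ℕ} (f : M ↪ₑ[L] N)
    (p : TypeOver L N n) : TypeOver L M n where
  toTheory := {ψ | ((L.lhomWithConstantsMap f).addConstants (Fin n)).onSentence ψ ∈ p}
  subset' := by
    rintro _ ⟨ψ, hψ, rfl⟩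
    have key : N ⊨ (L.lhomWithConstantsMap f).onSentence ψ := by
      let : (constantsOn M).Structure N := constantsOn.structure f
      have : (L.lhomWithConstantsMap f).IsExpansionOn N := by
        constructor
        · intro k g x
          rcases g with g | g
          · rfl
          · cases k with
            | zero => rfl
            | succ k => exact g.elim
        · intro k R x
          rcases R with R | R
          · rfl
          · exact R.elim
      rw [LHom.realize_onSentence]
      have h1 := (Formula.realize_equivSentence_symm_con N ψ)
      have h2 := (Formula.realize_equivSentence_symm_con M ψ)
      rw [← h1]
      have h3 := f.map_formula (Formula.equivSentence.symm ψ) (fun a => (L.con a : M))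
      exact h3.2 (h2.2 hψ)
    have h4 : (L[[N]].lhomWithConstants (Fin n)).onSentence
        ((L.lhomWithConstantsMap f).onSentence ψ) ∈ (p : L[[N]][[Fin n]].Theory) :=
      p.subset ⟨_, key, rfl⟩
    have h5 : ((L.lhomWithConstantsMap f).addConstants (Fin n)).onSentence
        ((L[[M]].lhomWithConstants (Fin n)).onSentence ψ)
        = (L[[N]].lhomWithConstants (Fin n)).onSentence
          ((L.lhomWithConstantsMap f).onSentence ψ) := by
      have e1 := LHom.comp_onBoundedFormula (n := 0) (α := Empty)
        ((L.lhomWithConstantsMap f).addConstants (Fin n)) (L[[M]].lhomWithConstants (Fin n))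
      have e2 := LHom.comp_onBoundedFormula (n := 0) (α := Empty)
        (L[[N]].lhomWithConstants (Fin n)) (L.lhomWithConstantsMap f)
      exact (congrFun e1 ψ).symm.trans (congrFun e2 ψ)
    show _ ∈ (p : L[[N]][[Fin n]].Theory)
    exact h5 ▸ h4
  isMaximal' := by
    refine ⟨?_, fun ψ => p.mem_or_not_mem _⟩
    refine Theory.isSatisfiable_of_isSatisfiable_onTheory
      ((L.lhomWithConstantsMap f).addConstants (Fin n)) (p.isMaximal.1.mono ?_)
    rintro _ ⟨ψ, hψ, rfl⟩
    exact hψ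

/-- The restriction `p|_M` of a type over `C` to an elementary substructure `M`. -/
def restrict {C : Type w} [L.Structure C] {n : ℕ} (p : TypeOver L C n)
    (M : L.ElementarySubstructure C) : TypeOver L M n :=
  pullback M.subtype p

/-- The conjugate `σ(p) = {φ(x, σ(b)) : φ(x, b) ∈ p}` of a type over `C` under an automorphism
`σ` of `C`; equivalently `φ(x, b) ∈ σ(p)` iff `φ(x, σ⁻¹(b)) ∈ p`. -/
def conj {C : Type w} [L.Structure C] {n : ℕ} (σ : C ≃[L] C) (p : TypeOver L C n) :
    TypeOver L C n :=
  pullback σ.symm.toElementaryEmbedding p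

/-- `p(x)` is finitely satisfiable in the set `A` of `n`-tuples: whenever `φ(x, b) ∈ p`,
`φ(a, b)` holds for some `a ∈ A`. -/
def FinitelySatisfiableIn {M : Type w} [L.Structure M] {n : ℕ} (p : TypeOver L M n)
    (A : Set (Fin n → M)) : Prop :=
  ∀ (m : ℕ) (φ : L.Formula (Fin n ⊕ Fin m)) (b : Fin m → M),
    p.Has φ b → ∃ a ∈ A, φ.Realize (Sum.elim a b)

/-- The global type `p` splinters over `M`: some automorphism `σ` of `C` satisfies `σ(M) = M`
setwise, `σ(p|_M) = p|_M` and `σ(p) ≠ p`. Since `σ(M) = M`, the type `σ(p|_M)` over `σ(M)` is the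
restriction of `σ(p)` to `M`. -/
def Splinters {C : Type w} [L.Structure C] {n : ℕ} (p : TypeOver L C n)
    (M : L.ElementarySubstructure C) : Prop :=
  ∃ σ : C ≃[L] C, p.conj σ ≠ p ∧ (p.conj σ).restrict M = p.restrict M ∧
    σ '' (M : Set C) = (M : Set C)

/-- The global type `p` splits over `M`: there are tuples `b`, `c` with the same type over `M` and
a formula `φ(x, y)` such that `φ(x, b) ∈ p` and `φ(x, c) ∉ p`. -/
def Splits {C : Type w} [L.Structure C] {n : ℕ} (p : TypeOver L C n)
    (M : L.ElementarySubstructure C) : Prop :=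
  ∃ (m : ℕ) (b c : Fin m → C),
    (∀ ψ : L[[(M : Set C)]].Formula (Fin m), ψ.Realize b ↔ ψ.Realize c) ∧
    ∃ φ : L.Formula (Fin n ⊕ Fin m), p.Has φ b ∧ ¬ p.Has φ c

end TypeOver

end Types

section Expansion

variable (L : Language.{u, v}) (n : ℕ)

/-- The new relation symbols `d_p x φ(x, y)`: one symbol, of arity the length of `y`, for each
`L`-formula `φ(x, y)` with `x` of length `n`. -/
def dpLanguage : Language.{0, max u v} where
  Functions _ := Empty
  Relations m := L.Formula (Fin n ⊕ Fin m)

/-- The relation symbols of the language having just one `n`-ary relation symbol `P`. -/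
inductive PredicateSymbol (n : ℕ) : ℕ → Type
  | P : PredicateSymbol n n

/-- The language with a single relation symbol, of arity `n`. -/
def predicateLanguage : Language.{0, 0} where
  Functions _ := Empty
  Relations := PredicateSymbol n

/-- `L_p`: the language `L` together with all the symbols `d_p x φ(x, y)`. -/
abbrev externalLanguage : Language.{max u 0, max v u v} := L.sum (dpLanguage L n)

/-- `L_p` together with one further `n`-ary predicate `P`. -/
abbrev externalLanguageWithPredicate : Language.{max u 0, max v u v} :=
  (externalLanguage L n).sum (predicateLanguage n)

variable {L n}

/-- `d_p x φ(x, y)` is interpreted as `{b : φ(x, b) ∈ p}`. -/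
abbrev dpStructure {M : Type w} [L.Structure M] (p : TypeOver L M n) :
    (dpLanguage L n).Structure M where
  funMap := fun f _ => f.elim
  RelMap := fun {m} (φ : L.Formula (Fin n ⊕ Fin m)) b => p.Has φ b

/-- `P` is interpreted as the set `A` of `n`-tuples. -/
abbrev predicateStructure {M : Type w} (A : Set (Fin n → M)) :
    (predicateLanguage n).Structure M where
  funMap := fun f _ => f.elim
  RelMap := fun R =>
    match R with
    | .P => fun b => b ∈ A

/-- The structure `(M_p, A)`. -/
abbrev externalStructure {M : Type w} [L.Structure M] (p : TypeOver L M n)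
    (A : Set (Fin n → M)) : (externalLanguageWithPredicate L n).Structure M :=
  letI := dpStructure p
  letI := predicateStructure A
  inferInstance

/-- `Th(M_p, A)`. -/
def externalTheory {M : Type w} [L.Structure M] (p : TypeOver L M n) (A : Set (Fin n → M)) :
    (externalLanguageWithPredicate L n).Theory :=
  letI := externalStructure p A
  (externalLanguageWithPredicate L n).completeTheory M

end Expansion

section SPExample

variable {L : Language.{u, v}}

/-- `(M, p, φ(x, y), A₁, A₂)` is an sp-example for `Th(M)`; here `x` and `y` are finite tuples of
variables of length `n` and `m`, and `A₁`, `A₂` are sets of `n`-tuples. -/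
structure IsSPExample (M : Type w) [L.Structure M] {n m : ℕ} (p : TypeOver L M n)
    (φ : L.Formula (Fin n ⊕ Fin m)) (A₁ A₂ : Set (Fin n → M)) : Prop where
  nonempty_left : A₁.Nonempty
  nonempty_right : A₂.Nonempty
  disjoint : Disjoint A₁ A₂
  finitelySatisfiable : p.FinitelySatisfiableIn A₁
  theory_eq : externalTheory p A₁ = externalTheory p A₂
  separated : ∀ s₁ s₂ : Set (Fin n → M), s₁.Finite → s₂.Finite → s₁ ⊆ A₁ → s₂ ⊆ A₂ →
    ∃ c : Fin m → M, (∀ a ∈ s₁, φ.Realize (Sum.elim a c)) ∧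
      ∀ b ∈ s₂, ¬ φ.Realize (Sum.elim b c)

/-- `T` has an sp-example. -/
def HasSPExample (T : L.Theory) : Prop :=
  ∃ (M : Theory.ModelType.{u, v, w} T) (n m : ℕ) (p : TypeOver L M n)
    (φ : L.Formula (Fin n ⊕ Fin m)) (A₁ A₂ : Set (Fin n → M)), IsSPExample M p φ A₁ A₂

end SPExample

section Monster

variable (L : Language.{u, v})

/-- `C` is a `κ`-monster model: `κ > |T| = |L| + ℵ₀`, `C` is `κ`-saturated and strongly
`κ`-homogeneous. Sets and models of size `< κ` are called small. -/
structure IsMonster (C : Type w) [L.Structure C] (κ : Cardinal.{w}) : Prop where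
  card_lt : Cardinal.lift.{w} (max Cardinal.aleph0 L.card) < Cardinal.lift.{max u v} κ
  /-- A set of formulas in finitely many variables over a small set of parameters that is
  finitely satisfiable in `C` is realized in `C`. -/
  saturated : ∀ A : Set C, Cardinal.mk A < κ → ∀ (n : ℕ) (Γ : Set (L[[A]].Formula (Fin n))),
    (∀ Γ₀ : Finset (L[[A]].Formula (Fin n)), (Γ₀ : Set (L[[A]].Formula (Fin n))) ⊆ Γ →
      ∃ c : Fin n → C, ∀ ψ ∈ Γ₀, ψ.Realize c) →
    ∃ c : Fin n → C, ∀ ψ ∈ Γ, ψ.Realize c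
  /-- A partial elementary map with small domain extends to an automorphism. -/
  homogeneous : ∀ A : Set C, Cardinal.mk A < κ → ∀ f : A → C,
    (∀ ψ : L.Formula A, ψ.Realize (fun a : A => (a : C)) ↔ ψ.Realize f) →
    ∃ σ : C ≃[L] C, ∀ a : A, σ a = f a

end Monster

end FirstOrder.Language

-- From splintering to an sp-example: if σ fixes M setwise and `p|_M` but moves p, some φ and c
-- satisfy φ(x,c) ∈ p and ¬φ(x,σ⁻¹c) ∈ p. Let A₁ be the set of tuples a of M with φ(a,c) ∧
-- ¬φ(a,σ⁻¹c), and let A₂ = σ(A₁). Finite satisfiability of p in M gives that of `p|_M` in A₁; σ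
-- restricts to an isomorphism (M_p,A₁) ≅ (M_p,A₂); and c itself separates A₁ from A₂, so
-- elementarity supplies a separating tuple in M for each pair of finite subsets
-- (`hasSPExample_of_splinters`).
--
-- Conversely, view M_p with both predicates A₁ and A₂ as one structure. Its two reducts (M_p,A₁)
-- and (M_p,A₂) are elementarily equivalent, so back-and-forth along an elementary chain yields a
-- small structure D, elementarily equivalent to the whole, with a bijection s that is an
-- isomorphism of the two reducts (`exists_equiv_of_reducts`, `IsSPExample.exists_automorphism`).
-- Embed D in the monster and extend s to an automorphism σ. An ultrafilter containing B₁ (the copy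
-- of A₁) and all sets prescribed by the d-relations of D has an average global type q, finitely
-- satisfiable in D, whose restriction to D is given by those relations and hence is σ-invariant.
-- Saturation gives c with φ(a,c) on B₁ and ¬φ(a,c) on B₂ = s(B₁). Then φ(x,c) ∈ q, whereas
-- φ(x,σ⁻¹c) fails throughout B₁, so q ≠ σ(q) (`exists_splinters_of_hasSPExample`).
--
-- The last claim follows because finite satisfiability in a model excludes splitting over it.

universe x y u' v'

namespace FirstOrder.Language

open Cardinal

/-! ### Compactness and amalgamation -/

/-- Compactness and Löwenheim–Skolem for a set of formulas in the variables `α`. -/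
theorem exists_realize_of_finite {K : Language.{u, v}} {X : Type x} [K.Structure X] [Infinite X]
    {α : Type w} (Γ : Set (K.Formula α)) (μ : Cardinal.{w}) (hμ : ℵ₀ ≤ μ)
    (hK : Cardinal.lift.{w} K.card ≤ Cardinal.lift.{max u v} μ) (hα : #α ≤ μ)
    (hΓ : ∀ Γ₀ : Finset (K.Formula α), (Γ₀ : Set (K.Formula α)) ⊆ Γ →
      ∃ a : α → X, ∀ φ ∈ Γ₀, φ.Realize a) :
    ∃ (N : Type w) (_ : K.Structure N) (a : α → N), #N = μ ∧ ∀ φ ∈ Γ, φ.Realize a := by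
  classical
  -- Infinity is put into the theory so that Löwenheim–Skolem gives a model of size exactly μ.
  let T : K[[α]].Theory := Formula.equivSentence '' Γ ∪ K[[α]].infiniteTheory
  have hT : T.IsSatisfiable := by
    rw [Theory.isSatisfiable_iff_isFinitelySatisfiable]
    intro T₀ hT₀
    obtain ⟨a, ha⟩ := hΓ ((T₀.image Formula.equivSentence.symm).filter (· ∈ Γ))
      (fun φ hφ => by simpa using (Finset.mem_filter.1 hφ).2)
    let : (constantsOn α).Structure X := constantsOn.structure a
    have : X ⊨ (T₀ : K[[α]].Theory) := by
      rw [Theory.model_iff]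
      intro ψ hψ
      rcases hT₀ hψ with ⟨φ, hφ, rfl⟩ | h
      · rw [Formula.realize_equivSentence]
        exact ha φ (Finset.mem_filter.2 ⟨Finset.mem_image.2 ⟨_, hψ, by simp⟩, hφ⟩)
      · exact Theory.realize_sentence_of_mem K[[α]].infiniteTheory h
    exact Theory.Model.isSatisfiable X
  obtain ⟨N₀⟩ := hT
  have hinf : Infinite N₀ := (model_infiniteTheory_iff _).1
    (N₀.is_model.mono Set.subset_union_right)
  obtain ⟨N, hN⟩ := Theory.exists_model_card_eq ⟨N₀, hinf⟩ μ hμ (by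
    simp only [card_withConstants, lift_add, lift_lift]
    refine add_le_of_le (by simpa using hμ) ?_ ?_
    · have h2 : Cardinal.lift.{max (max u w) v, w} μ = Cardinal.lift.{max u v, w} μ := by
        exact lift_umax.{w, max u v} ▸ rfl
      rw [h2]
      exact hK
    · simpa using hα)
  let := (K.lhomWithConstants α).reduct N
  refine ⟨N, inferInstance, fun i => (K.con i : N), hN, fun φ hφ => ?_⟩
  rw [← Formula.realize_equivSentence]
  exact Theory.realize_sentence_of_mem T (Or.inl ⟨φ, hφ, rfl⟩)

/-- Only finitely many variables occur in ψ: those in the range of h become parameters from P, the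
others are quantified existentially, and the resulting formula over P transfers by `hk`. Equalities
transfer too, so the choice of preimages under h is harmless. -/
theorem exists_realize_extending {L' : Language.{u', v'}} {P : Type y} {Q : Type w} {N : Type x}
    [L'.Structure Q] [L'.Structure N] [Nonempty N] (h : P → Q) (k : P → N)
    (hk : ∀ ψ : L'.Formula P, ψ.Realize h ↔ ψ.Realize k) (ψ : L'.Formula Q)
    (hψ : ψ.Realize (id : Q → Q)) :
    ∃ b : Q → N, (∀ p, b (h p) = k p) ∧ ψ.Realize b := by
  classical
  have hinj : ∀ p p', h p = h p' → k p = k p' := fun p p' hp => by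
    have := hk (Term.equal (Term.var p) (Term.var p'))
    simpa [hp] using this
  let f : ψ.freeVarFinset → P ⊕ ψ.freeVarFinset := fun q =>
    if hq : ∃ p, h p = q then Sum.inl hq.choose else Sum.inr q
  let ψ' : L'.Formula (P ⊕ ψ.freeVarFinset) := BoundedFormula.restrictFreeVar ψ f
  have h1 : (ψ'.iExs ψ.freeVarFinset).Realize h := by
    rw [Formula.realize_iExs]
    refine ⟨fun q => q, (BoundedFormula.realize_restrictFreeVar (id : Q → Q) fun q => ?_).2 hψ⟩
    by_cases hq : ∃ p, h p = q
    · simpa [f, hq] using hq.choose_spec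
    · simp [f, hq]
  rw [hk, Formula.realize_iExs] at h1
  obtain ⟨i, hi⟩ := h1
  let b : Q → N := fun q => if hq : ∃ p, h p = q then k hq.choose else
    if hq' : q ∈ ψ.freeVarFinset then i ⟨q, hq'⟩ else Classical.arbitrary N
  refine ⟨b, fun p => ?_, (BoundedFormula.realize_restrictFreeVar b fun q => ?_).1 hi⟩
  · have hp : ∃ p', h p' = h p := ⟨p, rfl⟩
    simpa [b] using hinj _ _ hp.choose_spec
  · by_cases hq : ∃ p, h p = q
    · simp [f, b, hq]
    · simp [f, b, hq]

/-- Amalgamation of an elementary extension of `N` with a structure `Q` along a common partial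
elementary map, elementarity on the side of `Q` being meant with respect to reducts. -/
theorem exists_amalgam {K : Language.{u, v}} {L' : Language.{u', v'}} (r₁ r₂ : L' →ᴸ K)
    {P : Type y} {Q N : Type w} [K.Structure Q] [K.Structure N] [Infinite N] (μ : Cardinal.{w})
    (hμ : ℵ₀ ≤ μ) (hK : Cardinal.lift.{w} K.card ≤ Cardinal.lift.{max u v} μ)
    (hQ : #Q ≤ μ) (hN : #N ≤ μ) (h : P → Q) (k : P → N)
    (hk : ∀ ψ : L'.Formula P, (r₂.onFormula ψ).Realize h ↔ (r₁.onFormula ψ).Realize k) :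
    ∃ (N' : Type w) (_ : K.Structure N') (e : N ↪ₑ[K] N') (g : Q → N'), #N' = μ ∧
      (∀ ψ : L'.Formula Q, (r₂.onFormula ψ).Realize (id : Q → Q) ↔ (r₁.onFormula ψ).Realize g) ∧
      ∀ p, g (h p) = e (k p) := by
  classical
  -- The elementary diagram of N, the L'-diagram of Q translated from `r₂` to `r₁`, and the gluing
  -- equations. Each finite part is satisfied in N itself.
  let Γ₁ : Set (K.Formula (N ⊕ Q)) :=
    {χ | ∃ θ : K.Formula N, θ.Realize (id : N → N) ∧ χ = θ.relabel Sum.inl}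
  let Γ₂ : Set (K.Formula (N ⊕ Q)) :=
    {χ | ∃ ψ : L'.Formula Q, (r₂.onFormula ψ).Realize (id : Q → Q) ∧
      χ = (r₁.onFormula ψ).relabel Sum.inr}
  let Γ₃ : Set (K.Formula (N ⊕ Q)) :=
    {χ | ∃ p : P, χ = Term.equal (Term.var (Sum.inr (h p))) (Term.var (Sum.inl (k p)))}
  have hfin : ∀ Γ₀ : Finset (K.Formula (N ⊕ Q)), (Γ₀ : Set (K.Formula (N ⊕ Q))) ⊆ Γ₁ ∪ (Γ₂ ∪ Γ₃) →
      ∃ a : N ⊕ Q → N, ∀ φ ∈ Γ₀, φ.Realize a := by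
    intro Γ₀ hΓ₀
    let := r₂.reduct Q
    let := r₁.reduct N
    simp only [LHom.realize_onFormula] at hk
    let Γ' : Finset (K.Formula (N ⊕ Q)) := Γ₀.filter (· ∈ Γ₂)
    have hΓ' : ∀ χ : Γ', ∃ ψ : L'.Formula Q, (r₂.onFormula ψ).Realize (id : Q → Q) ∧
        (χ : K.Formula (N ⊕ Q)) = (r₁.onFormula ψ).relabel Sum.inr :=
      fun χ => (Finset.mem_filter.1 χ.2).2
    choose ψ hψ hχ using hΓ'
    simp only [LHom.realize_onFormula] at hψ
    obtain ⟨b, hb, hb'⟩ := exists_realize_extending h k hk (Formula.iInf ψ)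
      (Formula.realize_iInf.2 hψ)
    rw [Formula.realize_iInf] at hb'
    refine ⟨Sum.elim id b, fun φ hφ => ?_⟩
    rcases hΓ₀ hφ with ⟨θ, hθ, rfl⟩ | h2 | ⟨p, rfl⟩
    · simpa [Formula.realize_relabel] using hθ
    · have hφ' : φ ∈ Γ' := Finset.mem_filter.2 ⟨hφ, h2⟩
      have h3 := hχ ⟨φ, hφ'⟩
      simp only at h3
      rw [h3, Formula.realize_relabel, Sum.elim_comp_inr, LHom.realize_onFormula]
      exact hb' _
    · simp [hb]
  obtain ⟨N', sN', a, hN', ha⟩ := exists_realize_of_finite (Γ₁ ∪ (Γ₂ ∪ Γ₃)) μ hμ hK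
    (by rw [mk_sum, lift_id, lift_id]; exact add_le_of_le hμ hN hQ) hfin
  have h1 : ∀ θ : K.Formula N, θ.Realize (id : N → N) → θ.Realize (a ∘ Sum.inl) := fun θ hθ => by
    rw [← Formula.realize_relabel]
    exact ha _ (Or.inl ⟨θ, hθ, rfl⟩)
  have h2 : ∀ ψ : L'.Formula Q, (r₂.onFormula ψ).Realize (id : Q → Q) →
      (r₁.onFormula ψ).Realize (a ∘ Sum.inr) := fun ψ hψ => by
    rw [← Formula.realize_relabel]
    exact ha _ (Or.inr (Or.inl ⟨ψ, hψ, rfl⟩))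
  refine ⟨N', sN', ⟨a ∘ Sum.inl, fun n φ x => ?_⟩, a ∘ Sum.inr, hN', fun ψ => ⟨h2 ψ, fun hψ => ?_⟩,
    fun p => ?_⟩
  · have e1 := h1 (φ.relabel x)
    have e2 := h1 (φ.relabel x).not
    simp only [Formula.realize_relabel, Formula.realize_not, Function.id_comp] at e1 e2
    exact ⟨fun h' => by_contra fun hn => e2 hn h', e1⟩
  · by_contra hn
    exact h2 ψ.not hn hψ
  · have := ha _ (Or.inr (Or.inr ⟨p, rfl⟩))
    simp only [Formula.realize_equal, Term.realize_var] at this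
    exact this

/-! ### Elementary chains -/

theorem coe_natLERec_realize {K : Language.{u, v}} {G : ℕ → Type w} [∀ i, K.Structure (G i)]
    (f : ∀ i, G i ↪ₑ[K] G (i + 1)) {i j : ℕ} (hij : i ≤ j) {α : Type x} {l : ℕ}
    (φ : K.BoundedFormula α l) (a : α → G i) (xs : Fin l → G i) :
    φ.Realize (DirectedSystem.natLERec (fun n => (f n).toEmbedding) i j hij ∘ a)
      (DirectedSystem.natLERec (fun n => (f n).toEmbedding) i j hij ∘ xs) ↔ φ.Realize a xs := by
  induction j, hij using Nat.le_induction with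
  | base =>
    have : ⇑(DirectedSystem.natLERec (fun n => (f n).toEmbedding) i i le_rfl) = id := by
      funext z
      simp only [DirectedSystem.coe_natLERec]
      exact Nat.leRecOn_self z
    rw [this]; rfl
  | succ j hij ih =>
    rw [← ih, ← (f j).map_boundedFormula]
    have : ⇑(DirectedSystem.natLERec (fun n => (f n).toEmbedding) i (j + 1) (hij.trans j.le_succ)) =
        f j ∘ DirectedSystem.natLERec (fun n => (f n).toEmbedding) i j hij := by
      funext z
      simp only [DirectedSystem.coe_natLERec, Function.comp_apply]
      rw [Nat.leRecOn_succ hij]; rfl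
    rw [this]; rfl

/-- The union of an elementary chain of type `ω` is an elementary extension of its members. -/
theorem exists_elementary_union {K : Language.{u, v}} {G : ℕ → Type w} [∀ i, K.Structure (G i)]
    (f : ∀ i, G i ↪ₑ[K] G (i + 1)) (μ : Cardinal.{w}) (hμ : ℵ₀ ≤ μ) (hG : ∀ i, #(G i) ≤ μ) :
    ∃ (D : Type w) (_ : K.Structure D) (ι : ∀ i, G i ↪ₑ[K] D), #D ≤ μ ∧
      (∀ i x, ι (i + 1) (f i x) = ι i x) ∧
      ∀ (l : ℕ) (a : Fin l → D), ∃ i b, a = ι i ∘ b := by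
  let F := fun i j hij => DirectedSystem.natLERec (fun n => (f n).toEmbedding) i j hij
  let D := DirectLimit G F
  let ι := DirectLimit.of K ℕ G F
  have hι : ∀ {i j} (hij : i ≤ j) x, ι j (F i j hij x) = ι i x := fun hij x => DirectLimit.of_f
  have key : ∀ {l : ℕ} (φ : K.BoundedFormula Empty l) i (xs : Fin l → G i),
      φ.Realize (ι i ∘ default) (ι i ∘ xs) ↔ φ.Realize default xs := by
    intro l φ
    induction φ with
    | falsum => exact fun _ _ => Iff.rfl
    | equal => intros; simp [BoundedFormula.Realize, ← Sum.comp_elim, HomClass.realize_term]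
    | rel R ts =>
      intro i xs
      simp only [BoundedFormula.Realize, ← Sum.comp_elim, HomClass.realize_term]
      exact (ι i).map_rel R _
    | imp _ _ ih1 ih2 => intro i xs; simp [ih1, ih2]
    | all φ ih =>
      intro i xs
      refine ⟨fun h y => ?_, fun h z => ?_⟩
      · rw [← ih, Fin.comp_snoc]
        exact h (ι i y)
      -- The element z may come from a later stage than the parameters; both are moved to a common
      -- stage, where the induction hypothesis applies.
      · obtain ⟨j, y, rfl⟩ := DirectLimit.exists_of z
        have hi := le_max_left i j
        have hj := le_max_right i j
        have h1 := (coe_natLERec_realize f hi φ.all default xs).2 h (F j _ hj y)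
        rw [Unique.eq_default (_ ∘ default)] at h1
        have h2 := (ih (max i j) _).2 h1
        rw [Fin.comp_snoc, hι, ← Function.comp_assoc] at h2
        have h3 : ι (max i j) ∘ F i _ hi = ι i := funext (hι hi)
        rw [Unique.eq_default (_ ∘ default)] at h2 ⊢
        exact h3 ▸ h2
  refine ⟨D, inferInstance, fun i => ⟨ι i, fun n φ x => ?_⟩, ?_, fun i x => ?_, fun l a => ?_⟩
  · exact φ.realize_relabel_sumInr.symm.trans
      (_root_.trans (key _ i x) φ.realize_relabel_sumInr)
  · refine mk_quotient_le.trans ((mk_sigma _).trans_le ((sum_le_sum _ (fun _ => μ) hG).trans ?_))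
    simpa using (mul_eq_max (le_refl ℵ₀) hμ).le.trans (max_le hμ le_rfl)
  · show ι (i + 1) (f i x) = ι i x
    rw [← hι (Nat.le_succ i) x]
    congr 1
    simp only [F, DirectedSystem.coe_natLERec]
    exact (Nat.leRecOn_succ' (C := G) (next := fun {k} => f k) x).symm
  · exact DirectLimit.exists_quotient_mk'_sigma_mk'_eq G F a

/-- Each z takes the value of a chosen representative. Two representatives of z, moved to a common
stage, coincide there by injectivity of the map into D. -/
theorem exists_descend {G : ℕ → Type w} {D : Type x} {Y : Type y} (E : ∀ i, G i → G (i + 1))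
    (ι : ∀ i, G i → D) (hι : ∀ i x, ι (i + 1) (E i x) = ι i x)
    (hinj : ∀ i, Function.Injective (ι i)) (hsurj : ∀ z, ∃ i x, ι i x = z)
    (F : ∀ i, G i → Y) (hF : ∀ i x, F (i + 1) (E i x) = F i x) :
    ∃ s : D → Y, ∀ i x, s (ι i x) = F i x := by
  have hup : ∀ i j, i ≤ j → ∀ x, ∃ x', ι j x' = ι i x ∧ F j x' = F i x := by
    intro i j hij x
    induction j, hij using Nat.le_induction with
    | base => exact ⟨x, rfl, rfl⟩
    | succ j _ ih =>
      obtain ⟨x', h1, h2⟩ := ih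
      exact ⟨E j x', (hι j x').trans h1, (hF j x').trans h2⟩
  choose lev rep hrep using hsurj
  refine ⟨fun z => F (lev z) (rep z), fun i x => ?_⟩
  obtain ⟨x₁, h1, h2⟩ := hup (lev (ι i x)) _ (le_max_left _ i) (rep (ι i x))
  obtain ⟨x₂, h3, h4⟩ := hup i _ (le_max_right (lev (ι i x)) i) x
  show F _ _ = _
  rw [← h2, ← h4, hinj _ (h1.trans ((hrep _).trans h3.symm))]

/-! ### Back-and-forth between two reducts -/

/-- A stage of the back-and-forth construction of an isomorphism between the `r₁`-reduct and the
`r₂`-reduct of a structure. -/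
structure BackForthStage {K : Language.{u, v}} {L' : Language.{u', v'}} (r₁ r₂ : L' →ᴸ K)
    (μ : Cardinal.{w}) where
  /-- the domain -/
  M : Type w
  /-- the codomain -/
  N : Type w
  [structM : K.Structure M]
  [structN : K.Structure N]
  /-- the inclusion -/
  e : M ↪ₑ[K] N
  /-- the partial isomorphism -/
  f : M → N
  card_M : #M = μ
  card_N : #N = μ
  realize_f : ∀ ψ : L'.Formula M,
    (r₁.onFormula ψ).Realize (id : M → M) ↔ (r₂.onFormula ψ).Realize f

namespace BackForthStage

attribute [instance] structM structN

variable {K : Language.{u, v}} {L' : Language.{u', v'}} {r₁ r₂ : L' →ᴸ K} {μ : Cardinal.{w}}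

theorem realize_f_comp (S : BackForthStage r₁ r₂ μ) {α : Type x} (ψ : L'.Formula α) (a : α → S.M) :
    (r₁.onFormula ψ).Realize a ↔ (r₂.onFormula ψ).Realize (S.f ∘ a) := by
  have := S.realize_f (ψ.relabel a)
  let i₁ := r₁.reduct S.M
  let i₂ := r₂.reduct S.N
  simpa only [LHom.realize_onFormula, Formula.realize_relabel, Function.id_comp] using this

/-- The codomain is amalgamated with itself over the domain, embedded once by `f` and once by `e`.
The new map g goes from the second reduct to the first and inverts `f` up to the inclusions. -/
theorem exists_next (S : BackForthStage r₁ r₂ μ) (hμ : ℵ₀ ≤ μ)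
    (hK : Cardinal.lift.{w} K.card ≤ Cardinal.lift.{max u v} μ) :
    ∃ (N' : Type w) (_ : K.Structure N') (e : S.N ↪ₑ[K] N') (g : S.N → N'), #N' = μ ∧
      (∀ ψ : L'.Formula S.N,
        (r₂.onFormula ψ).Realize (id : S.N → S.N) ↔ (r₁.onFormula ψ).Realize g) ∧
      ∀ p, g (S.f p) = e (S.e p) := by
  have : Infinite S.N := infinite_iff.2 (hμ.trans S.card_N.ge)
  refine exists_amalgam r₁ r₂ μ hμ hK S.card_N.le S.card_N.le S.f S.e fun ψ => ?_
  rw [← S.realize_f]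
  exact (S.e.map_formula (r₁.onFormula ψ) id).symm

/-- The next stage, going in the other direction. -/
noncomputable def next (S : BackForthStage r₁ r₂ μ) (hμ : ℵ₀ ≤ μ)
    (hK : Cardinal.lift.{w} K.card ≤ Cardinal.lift.{max u v} μ) : BackForthStage r₂ r₁ μ :=
  let h := S.exists_next hμ hK
  letI := h.choose_spec.choose
  { M := S.N
    N := h.choose
    e := h.choose_spec.choose_spec.choose
    f := h.choose_spec.choose_spec.choose_spec.choose
    card_M := S.card_N
    card_N := h.choose_spec.choose_spec.choose_spec.choose_spec.1
    realize_f := h.choose_spec.choose_spec.choose_spec.choose_spec.2.1 }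

theorem next_f (S : BackForthStage r₁ r₂ μ) (hμ : ℵ₀ ≤ μ)
    (hK : Cardinal.lift.{w} K.card ≤ Cardinal.lift.{max u v} μ) (m : S.M) :
    (S.next hμ hK).f (S.f m) = (S.next hμ hK).e (S.e m) :=
  (S.exists_next hμ hK).choose_spec.choose_spec.choose_spec.choose_spec.2.2 m

end BackForthStage

/-- If two reducts of a structure `X` are elementarily equivalent, they become isomorphic in some
structure elementarily equivalent to `X`. -/
theorem exists_equiv_of_reducts {K : Language.{u, v}} {L' : Language.{u', v'}} (r₁ r₂ : L' →ᴸ K)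
    (X : Type x) [K.Structure X] [Infinite X] (μ : Cardinal.{w}) (hμ : ℵ₀ ≤ μ)
    (hK : Cardinal.lift.{w} K.card ≤ Cardinal.lift.{max u v} μ)
    (hX : ∀ ψ : L'.Sentence, X ⊨ r₁.onSentence ψ ↔ X ⊨ r₂.onSentence ψ) :
    ∃ (D : Type w) (_ : K.Structure D) (s : D ≃ D), #D ≤ μ ∧ (X ≅[K] D) ∧
      ∀ (n : ℕ) (ψ : L'.Formula (Fin n)) (a : Fin n → D),
        (r₁.onFormula ψ).Realize a ↔ (r₂.onFormula ψ).Realize (s ∘ a) := by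
  obtain ⟨⟨M, sM⟩, hXM, hM⟩ := exists_elementarilyEquivalent_card_eq K X μ hμ hK
  change #M = μ at hM
  change @ElementarilyEquivalent K X M _ sM at hXM
  have : Infinite M := infinite_iff.2 (hμ.trans hM.ge)
  -- Amalgamation over the empty set, where the compatibility condition is just elementary
  -- equivalence of the reducts.
  obtain ⟨N, sN, e, f, hN, hf, -⟩ := exists_amalgam r₂ r₁ μ hμ hK hM.le hM.le
    (default : Empty → M) (default : Empty → M) (fun ψ => by
      have := hX ψ
      rw [hXM.realize_sentence, hXM.realize_sentence] at this
      exact this)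
  let S₀ : BackForthStage r₁ r₂ μ := ⟨M, N, e, f, hM, hN, hf⟩
  -- Two steps at a time, since each one exchanges the roles of the reducts.
  let S : ℕ → BackForthStage r₁ r₂ μ :=
    fun i => Nat.rec (motive := fun _ => BackForthStage r₁ r₂ μ) S₀
      (fun _ T => (T.next hμ hK).next hμ hK) i
  let G : ℕ → Type w := fun i => (S i).M
  let E : ∀ i : ℕ, G i ↪ₑ[K] G (i + 1) := fun i => ((S i).next hμ hK).e.comp (S i).e
  obtain ⟨D, sD, ι, hD, hι, hfin⟩ := exists_elementary_union E μ hμ (fun i => (S i).card_M.le)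
  have hsurj : ∀ z : D, ∃ i x, ι i x = z := fun z => by
    obtain ⟨i, b, hb⟩ := hfin 1 (fun _ => z)
    exact ⟨i, b 0, (congrFun hb 0).symm⟩
  let T : ∀ i, BackForthStage r₂ r₁ μ := fun i => (S i).next hμ hK
  have h₁ : ∀ i (m : (S i).M), (T i).f ((S i).f m) = (T i).e ((S i).e m) :=
    fun i => (S i).next_f hμ hK
  have h₂ : ∀ i (m : (S i).N), (S (i + 1)).f ((T i).f m) = (S (i + 1)).e ((T i).e m) :=
    fun i => (T i).next_f hμ hK
  have hinj : ∀ i, Function.Injective (ι i) := fun i => (ι i).injective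
  have hι' : ∀ i (x : (S i).M), ι (i + 1) ((T i).e ((S i).e x)) = ι i x := hι
  -- s is the union of the forward maps and t that of the backward maps. `h₁` and `h₂` give both
  -- compatibility along the chain and the fact that s and t are mutually inverse.
  obtain ⟨s, hs⟩ := exists_descend (fun i => E i) (fun i => ι i) hι hinj hsurj
    (fun i m => ι (i + 1) ((T i).e ((S i).f m))) (fun i m => by
      have e1 : E i m = (T i).f ((S i).f m) := (h₁ i m).symm
      rw [e1, h₂]
      exact hι' (i + 1) _)
  obtain ⟨t, ht⟩ := exists_descend (fun i => E i) (fun i => ι i) hι hinj hsurj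
    (fun i m => ι (i + 1) ((T i).f ((S i).e m))) (fun i m => by
      have e1 : (S (i + 1)).e (E i m) = (S (i + 1)).f ((T i).f ((S i).e m)) := (h₂ i _).symm
      exact ((congrArg (fun y => ι (i + 2) ((T (i + 1)).f y)) e1).trans
        (congrArg (ι (i + 2)) (h₁ (i + 1) _))).trans (hι' (i + 1) _))
  have hts : ∀ z, t (s z) = z := fun z => by
    obtain ⟨i, x, rfl⟩ := hsurj z
    rw [hs]
    refine (ht (i + 1) _).trans ?_
    have e1 : (S (i + 1)).e ((T i).e ((S i).f x)) = (S (i + 1)).f ((T i).e ((S i).e x)) :=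
      (h₂ i _).symm.trans (congrArg (S (i + 1)).f (h₁ i x))
    exact ((congrArg (fun y => ι (i + 2) ((T (i + 1)).f y)) e1).trans
      (congrArg (ι (i + 2)) (h₁ (i + 1) _))).trans ((hι' (i + 1) _).trans (hι' i x))
  have hst : ∀ z, s (t z) = z := fun z => by
    obtain ⟨i, x, rfl⟩ := hsurj z
    rw [ht]
    refine (hs (i + 1) _).trans ?_
    rw [h₂]
    exact (hι' (i + 1) _).trans (hι' i x)
  refine ⟨D, sD, ⟨s, t, hts, hst⟩, hD, hXM.trans (ι 0).elementarilyEquivalent, fun n ψ a => ?_⟩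
  obtain ⟨i, b, rfl⟩ := hfin n a
  have e1 : s ∘ (ι i ∘ b) = ι (i + 1) ∘ ((T i).e ∘ ((S i).f ∘ b)) := funext fun k => hs i (b k)
  show _ ↔ (r₂.onFormula ψ).Realize (s ∘ (ι i ∘ b))
  rw [e1, (ι i).map_formula]
  refine ((S i).realize_f_comp ψ b).trans ?_
  exact ((T i).e.map_formula _ _).symm.trans ((ι (i + 1)).map_formula _ _).symm

/-! ### Complete types and formulas with parameters -/

variable {L : Language.{u, v}}

theorem realize_formulaAt_of_isExpansionOn {M : Type w} {X : Type x} [L.Structure X]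
    [L[[M]].Structure X] [(L.lhomWithConstants M).IsExpansionOn X] {n m : ℕ}
    (φ : L.Formula (Fin n ⊕ Fin m)) (b : Fin m → M) (a : Fin n → X) :
    (formulaAt φ b).Realize a ↔ φ.Realize (Sum.elim a fun j => (L.con (b j) : X)) := by
  unfold formulaAt Formula.Realize
  rw [BoundedFormula.realize_subst]
  have h : (fun k : Fin n ⊕ Fin m => Term.realize a (Sum.elim (fun i => Term.var i)
      (fun j => (L.con (b j)).term) k : L[[M]].Term (Fin n))) =
      Sum.elim a fun j => (L.con (b j) : X) := by
    funext k
    rcases k with i | j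
    · rfl
    · exact Term.realize_constants
  rw [h]
  exact LHom.realize_onFormula (L.lhomWithConstants M) φ

/-- Every formula with parameters in `M` is equivalent to one of the form `φ(x, b)`. -/
theorem exists_realize_formulaAt_iff {M : Type w} {n : ℕ} (χ : L[[M]].Formula (Fin n)) :
    ∃ (m : ℕ) (φ : L.Formula (Fin n ⊕ Fin m)) (b : Fin m → M),
      ∀ (X : Type x) [L[[M]].Structure X] (a : Fin n → X),
        (formulaAt φ b).Realize a ↔ χ.Realize a := by
  classical
  let θ : L.Formula (M ⊕ Fin n) := BoundedFormula.constantsVarsEquiv χ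
  let V := θ.freeVarFinset.toLeft
  let e := V.equivFin
  let f : θ.freeVarFinset → Fin n ⊕ Fin V.card := fun z =>
    match z with
    | ⟨Sum.inl c, h⟩ => Sum.inr (e ⟨c, Finset.mem_toLeft.2 h⟩)
    | ⟨Sum.inr i, _⟩ => Sum.inl i
  refine ⟨V.card, BoundedFormula.restrictFreeVar θ f, fun j => (e.symm j : M), fun X _ a => ?_⟩
  let := (L.lhomWithConstants M).reduct X
  rw [realize_formulaAt_of_isExpansionOn]
  refine Iff.trans (BoundedFormula.realize_restrictFreeVar
    (Sum.elim (fun c => (L.con c : X)) a) ?_) BoundedFormula.realize_constantsVarsEquiv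
  rintro ⟨c | i, h⟩
  · simp [f]
  · simp [f]

namespace TypeOver

variable {M : Type w} [L.Structure M] {n : ℕ}

/-- A complete type over `M` is realized in some structure. -/
theorem exists_realization (p : TypeOver L M n) :
    ∃ (X : Type (max u v w)) (_ : L.Structure X) (c : M → X) (a : Fin n → X),
      ∀ (m : ℕ) (φ : L.Formula (Fin n ⊕ Fin m)) (b : Fin m → M),
        p.Has φ b ↔ φ.Realize (Sum.elim a (c ∘ b)) := by
  obtain ⟨X⟩ := p.isMaximal.1
  let := (L[[M]].lhomWithConstants (Fin n)).reduct X
  let := (L.lhomWithConstants M).reduct X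
  refine ⟨X, inferInstance, fun d => (L.con d : X), fun i => (L[[M]].con i : X), fun m φ b => ?_⟩
  refine (p.isMaximal.mem_iff_models _).trans
    ((p.isMaximal.isComplete.realize_sentence_iff _ X).symm.trans ?_)
  rw [Formula.realize_equivSentence, realize_formulaAt_of_isExpansionOn]
  rfl

/-- Complete types respect equivalence in all structures, and every formula with parameters in M is
so equivalent to some φ(x,b). -/
theorem ext_has {p q : TypeOver L M n}
    (h : ∀ (m : ℕ) (φ : L.Formula (Fin n ⊕ Fin m)) (b : Fin m → M), p.Has φ b ↔ q.Has φ b) :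
    p = q := by
  refine SetLike.ext fun ψ => ?_
  obtain ⟨m, φ, b, hφ⟩ := exists_realize_formulaAt_iff (Formula.equivSentence.symm ψ)
  have key : ∀ r : TypeOver L M n, ψ ∈ r ↔ r.Has φ b := by
    intro r
    refine (r.isMaximal.mem_iff_models _).trans (Iff.trans ?_ (r.isMaximal.mem_iff_models _).symm)
    rw [Theory.models_sentence_iff, Theory.models_sentence_iff]
    refine forall_congr' fun X => ?_
    let := (L[[M]].lhomWithConstants (Fin n)).reduct X
    rw [Formula.realize_equivSentence, hφ X, Formula.realize_equivSentence_symm_con]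
  rw [key, key, h]

theorem has_not (p : TypeOver L M n) {m : ℕ} (φ : L.Formula (Fin n ⊕ Fin m)) (b : Fin m → M) :
    p.Has φ.not b ↔ ¬ p.Has φ b := by
  obtain ⟨X, _, c, a, h⟩ := p.exists_realization
  rw [h, h, Formula.realize_not]

theorem has_top (p : TypeOver L M n) {m : ℕ} (b : Fin m → M) : p.Has ⊤ b := by
  obtain ⟨X, _, c, a, h⟩ := p.exists_realization
  rw [h]
  exact Formula.realize_top.2 trivial

/-- Concatenating the parameters makes the conjunction a single instance, to which finite
satisfiability can be applied. -/
theorem exists_has_inf (p : TypeOver L M n) {m k : ℕ} {φ : L.Formula (Fin n ⊕ Fin m)}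
    {ψ : L.Formula (Fin n ⊕ Fin k)} {b : Fin m → M} {c : Fin k → M} (hφ : p.Has φ b)
    (hψ : p.Has ψ c) :
    ∃ (χ : L.Formula (Fin n ⊕ Fin (m + k))) (d : Fin (m + k) → M), p.Has χ d ∧
      ∀ a : Fin n → M, χ.Realize (Sum.elim a d) ↔
        φ.Realize (Sum.elim a b) ∧ ψ.Realize (Sum.elim a c) := by
  have hd₁ : Fin.append b c ∘ Fin.castAdd k = b := funext fun i => Fin.append_left b c i
  have hd₂ : Fin.append b c ∘ Fin.natAdd m = c := funext fun i => Fin.append_right b c i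
  refine ⟨φ.relabel (Sum.map id (Fin.castAdd k)) ⊓ ψ.relabel (Sum.map id (Fin.natAdd m)),
    Fin.append b c, ?_, fun a => ?_⟩
  · obtain ⟨X, _, e, a, h⟩ := p.exists_realization
    rw [h] at hφ hψ ⊢
    simp only [Formula.realize_inf, Formula.realize_relabel, Sum.elim_comp_map, Function.comp_id,
      Function.comp_assoc, hd₁, hd₂]
    exact ⟨hφ, hψ⟩
  · simp only [Formula.realize_inf, Formula.realize_relabel, Sum.elim_comp_map,
      Function.comp_id, hd₁, hd₂]

theorem has_pullback {M N : Type w} [L.Structure M] [L.Structure N] (f : M ↪ₑ[L] N)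
    (p : TypeOver L N n) {m : ℕ} (φ : L.Formula (Fin n ⊕ Fin m)) (b : Fin m → M) :
    (pullback f p).Has φ b ↔ p.Has φ (f ∘ b) := by
  let H := (L.lhomWithConstantsMap f).addConstants (Fin n)
  show H.onSentence (Formula.equivSentence (formulaAt φ b)) ∈ (p : L[[N]][[Fin n]].Theory) ↔ _
  refine (p.isMaximal.mem_iff_models _).trans (Iff.trans ?_ (p.isMaximal.mem_iff_models _).symm)
  rw [Theory.models_sentence_iff, Theory.models_sentence_iff]
  refine forall_congr' fun X => ?_
  let := (L[[N]].lhomWithConstants (Fin n)).reduct X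
  let := (L.lhomWithConstants N).reduct X
  let := H.reduct X
  let := (L[[M]].lhomWithConstants (Fin n)).reduct X
  have : (L.lhomWithConstants M).IsExpansionOn X := ⟨fun _ _ => rfl, fun _ _ => rfl⟩
  rw [Formula.realize_equivSentence, realize_formulaAt_of_isExpansionOn,
    LHom.realize_onSentence, Formula.realize_equivSentence, realize_formulaAt_of_isExpansionOn]
  rfl

theorem has_conj {C : Type w} [L.Structure C] (σ : C ≃[L] C) (p : TypeOver L C n) {m : ℕ}
    (φ : L.Formula (Fin n ⊕ Fin m)) (b : Fin m → C) :
    (p.conj σ).Has φ b ↔ p.Has φ (σ.symm ∘ b) :=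
  has_pullback _ _ _ _

theorem has_restrict {C : Type w} [L.Structure C] (p : TypeOver L C n)
    (M : L.ElementarySubstructure C) {m : ℕ} (φ : L.Formula (Fin n ⊕ Fin m)) (b : Fin m → M) :
    (p.restrict M).Has φ b ↔ p.Has φ (Subtype.val ∘ b) :=
  has_pullback _ _ _ _

/-- The average type of an ultrafilter on the set of `n`-tuples. -/
def ofUltrafilter [Nonempty M] (U : Ultrafilter (Fin n → M)) : TypeOver L M n where
  toTheory := {ψ | ∀ᶠ a : Fin n → M in (U : Filter (Fin n → M)), (Formula.equivSentence.symm ψ).Realize a}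
  subset' := by
    rintro _ ⟨ψ, hψ, rfl⟩
    refine Filter.Eventually.of_forall fun a => ?_
    rw [Formula.realize_equivSentence_symm]
    let : (constantsOn (Fin n)).Structure M := constantsOn.structure a
    exact (LHom.realize_onSentence M (L[[M]].lhomWithConstants (Fin n)) ψ).2 hψ
  isMaximal' := by
    classical
    refine ⟨?_, fun ψ => ?_⟩
    · rw [Theory.isSatisfiable_iff_isFinitelySatisfiable]
      intro T₀ hT₀
      obtain ⟨a, ha⟩ := ((Filter.eventually_all_finset T₀).2 fun ψ hψ => hT₀ (Finset.mem_coe.2 hψ)).exists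
      let : (constantsOn (Fin n)).Structure M := constantsOn.structure a
      have : M ⊨ (T₀ : L[[M]][[Fin n]].Theory) := by
        rw [Theory.model_iff]
        exact fun ψ hψ => (Formula.realize_equivSentence_symm _ _ _).1 (ha ψ hψ)
      exact Theory.Model.isSatisfiable M
    · rw [Set.mem_ofPred_eq, Set.mem_ofPred_eq, or_iff_not_imp_left, ← Ultrafilter.eventually_not]
      refine fun h => h.mono fun a ha => ?_
      rw [Formula.realize_equivSentence_symm] at ha ⊢
      exact ha

theorem has_ofUltrafilter [Nonempty M] (U : Ultrafilter (Fin n → M)) {m : ℕ}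
    (φ : L.Formula (Fin n ⊕ Fin m)) (b : Fin m → M) :
    (ofUltrafilter U : TypeOver L M n).Has φ b ↔ ∀ᶠ a in U, φ.Realize (Sum.elim a b) := by
  show (∀ᶠ a : Fin n → M in (U : Filter (Fin n → M)), (Formula.equivSentence.symm (Formula.equivSentence
    (formulaAt φ b))).Realize a) ↔ _
  simp only [_root_.Equiv.symm_apply_apply, realize_formulaAt]

/-- Types finitely satisfiable in a model do not split over it. -/
theorem not_splits_of_finitelySatisfiableIn {C : Type w} [L.Structure C]
    {M : L.ElementarySubstructure C} {p : TypeOver L C n}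
    (hp : p.FinitelySatisfiableIn {a | ∀ i, a i ∈ M}) : ¬ p.Splits M := by
  rintro ⟨m, b, c, hbc, φ, hb, hc⟩
  -- φ(x,b) ∧ ¬φ(x,c) is realized by some a in M, and then φ(a,y) is a formula over M distinguishing
  -- b from c.
  obtain ⟨χ, d, hχ, hd⟩ := p.exists_has_inf hb ((p.has_not φ c).2 hc)
  obtain ⟨a, ha, har⟩ := hp _ χ d hχ
  rw [hd, Formula.realize_not] at har
  let ψ : L[[(M : Set C)]].Formula (Fin m) := BoundedFormula.constantsVarsEquiv.symm
    (φ.relabel (Sum.map (fun i => (⟨a i, ha i⟩ : (M : Set C))) id))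
  have hψ : ∀ y : Fin m → C, ψ.Realize y ↔ φ.Realize (Sum.elim a y) := by
    intro y
    refine (BoundedFormula.realize_constantsVarsEquiv).symm.trans ?_
    have e : BoundedFormula.constantsVarsEquiv ψ =
        φ.relabel (Sum.map (fun i => (⟨a i, ha i⟩ : (M : Set C))) id) :=
      _root_.Equiv.apply_symm_apply _ _
    rw [e]
    refine Formula.realize_relabel.trans ?_
    rw [Sum.elim_comp_map, Function.comp_id]
    rfl
  exact har.2 ((hψ c).1 ((hbc ψ).1 ((hψ b).2 har.1)))

end TypeOver

/-! ### Saturation and homogeneity of the monster model -/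

/-- To compare the formulas satisfied by two families it suffices to look at finite subfamilies. -/
theorem realize_iff_of_forall_fin {D : Type x} {C : Type y} [L.Structure D] [L.Structure C]
    {α : Type w} (a : α → D) (b : α → C)
    (h : ∀ (l : ℕ) (ψ : L.Formula (Fin l)) (i : Fin l → α),
      ψ.Realize (a ∘ i) ↔ ψ.Realize (b ∘ i)) (ψ : L.Formula α) :
    ψ.Realize a ↔ ψ.Realize b := by
  classical
  have e := Fintype.equivFin ψ.freeVarFinset
  have h1 := h _ (Formula.relabel e (BoundedFormula.restrictFreeVar ψ id)) (fun k => e.symm k)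
  rw [Formula.realize_relabel, Formula.realize_relabel] at h1
  refine (BoundedFormula.realize_restrictFreeVar a fun z => ?_).symm.trans
    (h1.trans (BoundedFormula.realize_restrictFreeVar b fun z => ?_)) <;> simp

namespace IsMonster

variable {C : Type w} [L.Structure C] {κ : Cardinal.{w}}

/-- Saturation for formulas with parameters given by a small family of elements. -/
theorem exists_realize (hC : L.IsMonster C κ) {α : Type w} (hα : #α < κ) (c : α → C) {m : ℕ}
    (Γ : Set (L.Formula (α ⊕ Fin m)))
    (hΓ : ∀ Γ₀ : Finset (L.Formula (α ⊕ Fin m)), (Γ₀ : Set _) ⊆ Γ →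
      ∃ y : Fin m → C, ∀ φ ∈ Γ₀, φ.Realize (Sum.elim c y)) :
    ∃ y : Fin m → C, ∀ φ ∈ Γ, φ.Realize (Sum.elim c y) := by
  classical
  let F : L.Formula (α ⊕ Fin m) → L[[Set.range c]].Formula (Fin m) := fun φ =>
    BoundedFormula.constantsVarsEquiv.symm (φ.relabel (Sum.map (Set.rangeFactorization c) id))
  have hF : ∀ φ (y : Fin m → C), (F φ).Realize y ↔ φ.Realize (Sum.elim c y) := by
    intro φ y
    refine (BoundedFormula.realize_constantsVarsEquiv).symm.trans ?_
    have e : BoundedFormula.constantsVarsEquiv (F φ) =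
        φ.relabel (Sum.map (Set.rangeFactorization c) id) := _root_.Equiv.apply_symm_apply _ _
    rw [e]
    refine Formula.realize_relabel.trans ?_
    rw [Sum.elim_comp_map, Function.comp_id]
    rfl
  obtain ⟨y, hy⟩ := hC.saturated (Set.range c) (mk_range_le.trans_lt hα) m (F '' Γ) (by
    intro Γ₀ hΓ₀
    obtain ⟨Γ₁, hΓ₁, rfl⟩ := Finset.subset_set_image_iff.1 hΓ₀
    obtain ⟨y, hy⟩ := hΓ Γ₁ hΓ₁
    refine ⟨y, fun ψ hψ => ?_⟩
    obtain ⟨φ, hφ, rfl⟩ := Finset.mem_image.1 hψ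
    exact (hF φ y).2 (hy φ hφ))
  exact ⟨y, fun φ hφ => (hF φ y).1 (hy _ ⟨φ, hφ, rfl⟩)⟩

/-- A small model elementarily equivalent to a monster model embeds into it. -/
theorem nonempty_elementaryEmbedding (hC : L.IsMonster C κ) {D : Type w} [L.Structure D]
    (hD : #D < κ) (hDC : D ≅[L] C) : Nonempty (D ↪ₑ[L] C) := by
  classical
  -- Partial elementary maps are handled as relations, so that Zorn's lemma applies to inclusion.
  -- Equality formulas force them to be injective functions.
  let PE : Set (D × C) → Prop := fun R => ∀ (l : ℕ) (ψ : L.Formula (Fin l)) (r : Fin l → D × C),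
    (∀ i, r i ∈ R) → (ψ.Realize (Prod.fst ∘ r) ↔ ψ.Realize (Prod.snd ∘ r))
  have h₀ : PE ∅ := by
    intro l ψ r hr
    have : IsEmpty (Fin l) := ⟨fun i => hr i⟩
    have h1 := hDC.realize_sentence (ψ.relabel (isEmptyElim : Fin l → Empty))
    refine Iff.trans ?_ (h1.trans ?_)
    · refine Iff.trans ?_ Formula.realize_relabel.symm
      rw [Subsingleton.elim (Prod.fst ∘ r)]
    · refine Formula.realize_relabel.trans ?_
      rw [Subsingleton.elim (Prod.snd ∘ r)]
  obtain ⟨R, -, hR⟩ := zorn_subset_nonempty {R | PE R} (fun c hc hchain hne => by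
    refine ⟨⋃₀ c, fun l ψ r hr => ?_, fun s hs => Set.subset_sUnion_of_mem hs⟩
    obtain ⟨s, hs, hrs⟩ := hchain.directedOn.exists_mem_subset_of_finite_of_subset_sUnion hne
      (Set.finite_range r) (Set.range_subset_iff.2 hr)
    exact hc hs l ψ r fun i => hrs ⟨i, rfl⟩) ∅ h₀
  have hPE : PE R := hR.prop
  have hPE' : ∀ ψ : L.Formula R,
      ψ.Realize (fun r : R => r.1.1) ↔ ψ.Realize (fun r : R => r.1.2) :=
    realize_iff_of_forall_fin _ _ fun l ψ i => hPE l ψ (fun k => i k) fun k => (i k).2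
  have hcard : #R < κ := by
    refine lt_of_le_of_lt (mk_le_of_injective (f := fun r : R => r.1.1) ?_) hD
    intro r r' hrr
    have := (hPE' (Term.equal (Term.var r) (Term.var r'))).1 (by simpa using hrr)
    exact Subtype.ext (Prod.ext hrr (by simpa using this))
  have htot : ∀ d, ∃ c, (d, c) ∈ R := by
    intro d
    -- The type of d over the domain of R, to be realized over the range of R; R is small because it
    -- injects into D.
    let Γ : Set (L.Formula (R ⊕ Fin 1)) :=
      {φ | φ.Realize (Sum.elim (fun r : R => r.1.1) fun _ => d)}
    obtain ⟨y, hy⟩ := hC.exists_realize hcard (fun r : R => r.1.2) Γ (fun Γ₀ hΓ₀ => by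
      have h1 := (hPE' ((Formula.iInf fun φ : Γ₀ => (φ : L.Formula (R ⊕ Fin 1))).iExs (Fin 1))).1
        (Formula.realize_iExs.2 ⟨fun _ => d, Formula.realize_iInf.2 fun φ => hΓ₀ φ.2⟩)
      obtain ⟨y, hy⟩ := Formula.realize_iExs.1 h1
      exact ⟨y, fun φ hφ => Formula.realize_iInf.1 hy ⟨φ, hφ⟩⟩)
    have hy' : ∀ φ : L.Formula (R ⊕ Fin 1),
        φ.Realize (Sum.elim (fun r : R => r.1.1) fun _ => d) ↔
          φ.Realize (Sum.elim (fun r : R => r.1.2) y) :=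
      fun φ => ⟨hy φ, fun h => by_contra fun hn => hy φ.not hn h⟩
    have hins : PE (insert (d, y 0) R) := by
      intro l ψ r hr
      let g : Fin l → R ⊕ Fin 1 := fun i => if h : r i ∈ R then Sum.inl ⟨r i, h⟩ else Sum.inr 0
      have h1 : Prod.fst ∘ r = Sum.elim (fun r : R => r.1.1) (fun _ => d) ∘ g := by
        funext i
        by_cases h : r i ∈ R
        · simp [g, h]
        · simp only [g, Function.comp_apply, dif_neg h, Sum.elim_inr]
          rw [(hr i).resolve_right h]
      have h2 : Prod.snd ∘ r = Sum.elim (fun r : R => r.1.2) y ∘ g := by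
        funext i
        by_cases h : r i ∈ R
        · simp [g, h]
        · simp only [g, Function.comp_apply, dif_neg h, Sum.elim_inr]
          rw [(hr i).resolve_right h]
      rw [h1, h2, ← Formula.realize_relabel, ← Formula.realize_relabel, hy']
    exact ⟨y 0, hR.le_of_ge hins (Set.subset_insert _ _) (Set.mem_insert _ _)⟩
  choose f hf using htot
  exact ⟨⟨f, fun l ψ a => (hPE l ψ (fun i => (a i, f (a i))) fun i => hf (a i)).symm⟩⟩

/-- Homogeneity, for automorphisms of an elementarily embedded small structure. -/
theorem exists_extend (hC : L.IsMonster C κ) {D : Type w} [L.Structure D] (hD : #D < κ)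
    (j : D ↪ₑ[L] C) (s : D → D)
    (hs : ∀ (l : ℕ) (ψ : L.Formula (Fin l)) (a : Fin l → D), ψ.Realize a ↔ ψ.Realize (s ∘ a)) :
    ∃ σ : C ≃[L] C, ∀ d, σ (j d) = j (s d) := by
  have hs' : ∀ {α : Type w} (ψ : L.Formula α) (a : α → D), ψ.Realize a ↔ ψ.Realize (s ∘ a) :=
    let e : D ↪ₑ[L] D := ⟨s, fun l ψ a => (hs l ψ a).symm⟩
    fun ψ a => (e.map_formula ψ a).symm
  let e := _root_.Equiv.ofInjective j j.injective
  obtain ⟨σ, hσ⟩ := hC.homogeneous (Set.range j) (mk_range_le.trans_lt hD)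
    (fun a => j (s (e.symm a))) (fun ψ => by
      have h1 : (fun a : Set.range j => (a : C)) = j ∘ e.symm :=
        funext fun a => (Equiv.apply_ofInjective_symm j.injective a).symm
      rw [h1, j.map_formula, hs' ψ, ← j.map_formula]
      rfl)
  refine ⟨σ, fun d => ?_⟩
  have := hσ (e d)
  rwa [_root_.Equiv.symm_apply_apply] at this

end IsMonster

/-! ### From splintering to an sp-example -/

theorem externalTheory_eq_of_equiv {M : Type w} [L.Structure M] {n : ℕ} {p : TypeOver L M n}
    {A₁ A₂ : Set (Fin n → M)} (τ : M ≃[L] M)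
    (hp : ∀ (m : ℕ) (φ : L.Formula (Fin n ⊕ Fin m)) (b : Fin m → M),
      p.Has φ (τ ∘ b) ↔ p.Has φ b)
    (hA : ∀ a, τ ∘ a ∈ A₂ ↔ a ∈ A₁) : externalTheory p A₁ = externalTheory p A₂ := by
  let i₁ := externalStructure p A₁
  let i₂ := externalStructure p A₂
  let τ' : @Equiv (externalLanguageWithPredicate L n) M M i₁ i₂ :=
    @Equiv.mk _ _ _ i₁ i₂ τ.toEquiv
      (fun {k} f x => by
        rcases f with (f | f) | f
        · exact τ.map_fun f x
        · exact f.elim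
        · exact f.elim)
      (fun {k} R x => by
        rcases R with (R | φ) | R
        · exact τ.map_rel R x
        · exact hp k φ x
        · cases R
          exact hA x)
  exact @ElementaryEmbedding.elementarilyEquivalent _ M M i₁ i₂
    (@Equiv.toElementaryEmbedding _ M M i₁ i₂ τ')

/-- Finitely many conditions on c form one formula over M, whose solvability descends from C. -/
theorem ElementaryEmbedding.exists_separating {M C : Type w} [L.Structure M] [L.Structure C]
    (e : M ↪ₑ[L] C) {n m : ℕ} (φ : L.Formula (Fin n ⊕ Fin m)) {s₁ s₂ : Set (Fin n → M)}
    (h₁ : s₁.Finite) (h₂ : s₂.Finite)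
    (h : ∃ c : Fin m → C, (∀ a ∈ s₁, φ.Realize (Sum.elim (e ∘ a) c)) ∧
      ∀ a ∈ s₂, ¬ φ.Realize (Sum.elim (e ∘ a) c)) :
    ∃ c : Fin m → M, (∀ a ∈ s₁, φ.Realize (Sum.elim a c)) ∧
      ∀ a ∈ s₂, ¬ φ.Realize (Sum.elim a c) := by
  have := h₁.to_subtype
  have := h₂.to_subtype
  let θ : L.Formula (M ⊕ Fin m) :=
    Formula.iInf (fun a : s₁ => φ.relabel (Sum.map a id)) ⊓
      Formula.iInf (fun a : s₂ => (φ.relabel (Sum.map a id)).not)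
  have hθ : ∀ {N : Type w} [L.Structure N] (d : M → N) (c : Fin m → N),
      θ.Realize (Sum.elim d c) ↔ (∀ a ∈ s₁, φ.Realize (Sum.elim (d ∘ a) c)) ∧
        ∀ a ∈ s₂, ¬ φ.Realize (Sum.elim (d ∘ a) c) := by
    intro N _ d c
    simp only [θ, Formula.realize_inf, Formula.realize_iInf, Formula.realize_not,
      Formula.realize_relabel, Sum.elim_comp_map, Function.comp_id, Subtype.forall]
  obtain ⟨c, hc⟩ := h
  have h1 : (θ.iExs (Fin m)).Realize (e ∘ id) := Formula.realize_iExs.2 ⟨c, (hθ _ _).2 hc⟩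
  rw [e.map_formula, Formula.realize_iExs] at h1
  obtain ⟨c', hc'⟩ := h1
  exact ⟨c', (hθ id c').1 hc'⟩

theorem hasSPExample_of_splinters {T : L.Theory} {C : Type w} [L.Structure C] [Nonempty C]
    (hCT : C ⊨ T) {M : L.ElementarySubstructure C} {n : ℕ} {p : L.TypeOver C n}
    (hp : p.FinitelySatisfiableIn {a | ∀ i, a i ∈ M}) (hs : p.Splinters M) :
    HasSPExample.{u, v, w} T := by
  obtain ⟨σ, hne, hres, hσ⟩ := hs
  -- p and σ(p) differ on some formula; replacing it by its negation if necessary puts the positive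
  -- instance in p.
  obtain ⟨m, φ, c, hc, hc'⟩ : ∃ (m : ℕ) (φ : L.Formula (Fin n ⊕ Fin m)) (c : Fin m → C),
      p.Has φ c ∧ p.Has φ.not (σ.symm ∘ c) := by
    by_contra hcon
    push Not at hcon
    refine hne (TypeOver.ext_has fun m φ b => ?_)
    rw [TypeOver.has_conj]
    have h1 := hcon m φ b
    have h2 := hcon m φ.not b
    simp only [TypeOver.has_not, not_not] at h1 h2
    tauto
  have hσM : ∀ z, σ z ∈ M ↔ z ∈ M := fun z => by
    rw [← SetLike.mem_coe, ← hσ]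
    exact σ.injective.mem_set_image
  let τ : M ≃[L] M :=
    { toEquiv := σ.toEquiv.subtypeEquiv fun z => (hσM z).symm
      map_fun' := fun f x => Subtype.ext (σ.map_fun f _)
      map_rel' := fun R x => σ.map_rel R _ }
  -- A₁ is the trace on M of φ(x,c) ∧ ¬φ(x,σ⁻¹c) ∈ p, and A₂ is its image under σ. The condition on
  -- φ(a,c) alone makes them disjoint and separated by c.
  let A₁ : Set (Fin n → M) := {a | φ.Realize (Sum.elim (Subtype.val ∘ a) c) ∧
    ¬ φ.Realize (Sum.elim (Subtype.val ∘ a) (σ.symm ∘ c))}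
  let A₂ : Set (Fin n → M) := {a | φ.Realize (Sum.elim (Subtype.val ∘ a) (σ ∘ c)) ∧
    ¬ φ.Realize (Sum.elim (Subtype.val ∘ a) c)}
  have hreal : ∀ (a : Fin n → M) (d : Fin m → C),
      φ.Realize (Sum.elim (Subtype.val ∘ (τ ∘ a)) (σ ∘ d)) ↔
        φ.Realize (Sum.elim (Subtype.val ∘ a) d) := by
    intro a d
    rw [← StrongHomClass.realize_formula σ φ (v := Sum.elim (Subtype.val ∘ a) d), Sum.comp_elim]
    rfl
  have hA : ∀ a, τ ∘ a ∈ A₂ ↔ a ∈ A₁ := by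
    intro a
    have h1 := hreal a c
    have h2 := hreal a (σ.symm ∘ c)
    have h3 : σ ∘ (σ.symm ∘ c) = c := funext fun i => σ.apply_symm_apply (c i)
    rw [h3] at h2
    exact and_congr h1 (not_congr h2)
  have hfs : (p.restrict M).FinitelySatisfiableIn A₁ := by
    intro k ψ b hb
    rw [TypeOver.has_restrict] at hb
    obtain ⟨χ, d, hχ, hd⟩ := p.exists_has_inf hc hc'
    obtain ⟨χ', d', hχ', hd'⟩ := p.exists_has_inf hb hχ
    obtain ⟨a, ha, har⟩ := hp _ χ' d' hχ'
    rw [hd', hd, Formula.realize_not] at har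
    refine ⟨fun i => ⟨a i, ha i⟩, har.2, ?_⟩
    rw [← M.subtype.map_formula, Sum.comp_elim]
    exact har.1
  obtain ⟨a₀, ha₀, -⟩ := hfs 0 ⊤ Fin.elim0 ((p.restrict M).has_top _)
  have hMT : M ⊨ T := (M.theory_model_iff T).2 hCT
  have hpτ : ∀ (k : ℕ) (ψ : L.Formula (Fin n ⊕ Fin k)) (b : Fin k → M),
      (p.restrict M).Has ψ (τ ∘ b) ↔ (p.restrict M).Has ψ b := by
    intro k ψ b
    rw [← hres, TypeOver.has_restrict, TypeOver.has_conj, hres, TypeOver.has_restrict]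
    refine iff_of_eq (congrArg _ (funext fun i => ?_))
    exact σ.symm_apply_apply _
  refine ⟨Theory.ModelType.of T M, n, m, p.restrict M, φ, A₁, A₂, ⟨a₀, ha₀⟩,
    ⟨τ ∘ a₀, (hA a₀).2 ha₀⟩, ?_, hfs, externalTheory_eq_of_equiv τ hpτ hA, ?_⟩
  · exact Set.disjoint_left.2 fun a h₁ h₂ => h₂.2 h₁.1
  · intro s₁ s₂ h₁ h₂ hs₁ hs₂
    exact M.subtype.exists_separating φ h₁ h₂
      ⟨c, fun a ha => (hs₁ ha).1, fun a ha => (hs₂ ha).2⟩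

/-! ### Cardinality of the expanded languages -/

theorem card_dpLanguage_le (L : Language.{u, v}) (n : ℕ) :
    (dpLanguage L n).card ≤ max ℵ₀ L.card := by
  have h1 : ∀ m : ℕ, #(L.Formula (Fin n ⊕ Fin m)) ≤ max ℵ₀ L.card := fun m => by
    refine (mk_le_of_injective (f := fun φ : L.Formula (Fin n ⊕ Fin m) =>
      (⟨0, φ⟩ : Σ k, L.BoundedFormula (Fin n ⊕ Fin m) k)) ?_).trans
        (BoundedFormula.card_le.trans (max_le (le_max_left _ _) ?_))
    · intro φ ψ h
      simpa using h
    · refine add_le_of_le (le_max_left _ _) ?_ ?_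
      · exact ((lift_le_aleph0.2 mk_le_aleph0).trans (le_max_left _ _))
      · simp
  have h2 : (dpLanguage L n).card = #(Σ m : ℕ, L.Formula (Fin n ⊕ Fin m)) := by
    have : IsEmpty (Σ m, (dpLanguage L n).Functions m) := ⟨fun f => Empty.elim f.2⟩
    rw [card, Symbols, mk_sum, mk_eq_zero]
    simp [dpLanguage]
  rw [h2, mk_sigma]
  refine (sum_le_sum _ (fun _ => max ℵ₀ L.card) h1).trans ?_
  simp

theorem card_predicateLanguage_le (n : ℕ) : (predicateLanguage n).card ≤ ℵ₀ := by
  have : IsEmpty (Σ m, (predicateLanguage n).Functions m) := ⟨fun f => Empty.elim f.2⟩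
  have : Subsingleton (Σ m, (predicateLanguage n).Relations m) := by
    constructor
    rintro ⟨_, ⟨⟩⟩ ⟨_, ⟨⟩⟩
    rfl
  have : Countable (predicateLanguage n).Symbols := by
    unfold Symbols
    infer_instance
  exact mk_le_aleph0

theorem card_externalLanguageWithPredicate_sum_le (L : Language.{u, v}) (n : ℕ) :
    ((externalLanguageWithPredicate L n).sum (predicateLanguage n)).card ≤ max ℵ₀ L.card := by
  have h := le_max_left ℵ₀ L.card
  have h1 := (lift_le_aleph0.2 (card_predicateLanguage_le n)).trans h
  rw [card_sum, card_sum, card_sum]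
  simp only [lift_add, lift_lift]
  refine add_le_of_le h (add_le_of_le h (add_le_of_le h ?_ ?_) ?_) ?_
  · simp
  · simpa using card_dpLanguage_le L n
  · exact (lift_le_aleph0.2 (card_predicateLanguage_le n)).trans h
  · exact (lift_le_aleph0.2 (card_predicateLanguage_le n)).trans h

/-! ### First-order transfer of the properties of an sp-example -/

theorem ElementarilyEquivalent.forall_realize {K : Language.{u, v}} {N : Type x} {N' : Type y}
    [K.Structure N] [K.Structure N'] (h : N ≅[K] N') {α : Type w} [Finite α] (χ : K.Formula α)
    (hχ : ∀ a : α → N, χ.Realize a) (a : α → N') : χ.Realize a := by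
  let χ' : K.Formula (Empty ⊕ α) := χ.relabel Sum.inr
  have h1 : (χ'.iAlls α).Realize (default : Empty → N) :=
    Formula.realize_iAlls.2 fun b => Formula.realize_relabel.2 (hχ b)
  have h2 : (χ'.iAlls α).Realize (default : Empty → N') := (h.realize_sentence _).1 h1
  exact (Formula.realize_relabel (g := Sum.inr) (v := Sum.elim default a)).1
    (Formula.realize_iAlls.1 h2 a)

theorem ElementarilyEquivalent.of_isExpansionOn {L' : Language.{u', v'}} (ρ : L →ᴸ L')
    {N : Type x} {N' : Type y} [L.Structure N] [L'.Structure N] [L.Structure N'] [L'.Structure N']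
    [ρ.IsExpansionOn N] [ρ.IsExpansionOn N'] (h : N ≅[L'] N') : N ≅[L] N' := by
  rw [elementarilyEquivalent_iff]
  intro ψ
  rw [← LHom.realize_onSentence N ρ, ← LHom.realize_onSentence N' ρ, h.realize_sentence]

section External

variable {n : ℕ}

/-- The inclusion of `L` into `L_p` with a predicate. -/
def toExternal (L : Language.{u, v}) (n : ℕ) : L →ᴸ externalLanguageWithPredicate L n :=
  LHom.sumInl.comp LHom.sumInl

/-- The symbol `d_p x φ(x, y)`. -/
def dpSymbol {m : ℕ} (φ : L.Formula (Fin n ⊕ Fin m)) :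
    (externalLanguageWithPredicate L n).Relations m :=
  Sum.inl (Sum.inr φ)

/-- The predicate symbol `P`. -/
def predSymbol (L : Language.{u, v}) (n : ℕ) : (externalLanguageWithPredicate L n).Relations n :=
  Sum.inr PredicateSymbol.P

/-- Finite satisfiability in the interpretation of `P`, for an arbitrary structure. -/
def FinitelySatisfiableInPred (L : Language.{u, v}) (n : ℕ) (N : Type w) [L.Structure N]
    [(externalLanguageWithPredicate L n).Structure N] : Prop :=
  ∀ (ι : Type w) [Finite ι] (m : ι → ℕ) (φ : ∀ i, L.Formula (Fin n ⊕ Fin (m i)))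
    (b : ∀ i, Fin (m i) → N), (∀ i, Structure.RelMap (dpSymbol (φ i)) (b i)) →
    ∃ a : Fin n → N, Structure.RelMap (predSymbol L n) a ∧ ∀ i, (φ i).Realize (Sum.elim a (b i))

theorem FinitelySatisfiableInPred.of_equiv {N N' : Type w} [L.Structure N] [L.Structure N']
    [(externalLanguageWithPredicate L n).Structure N]
    [(externalLanguageWithPredicate L n).Structure N'] [(toExternal L n).IsExpansionOn N]
    [(toExternal L n).IsExpansionOn N'] (h : N ≅[externalLanguageWithPredicate L n] N')
    (hN : FinitelySatisfiableInPred L n N) : FinitelySatisfiableInPred L n N' := by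
  intro ι _ m φ b hb
  let χ : (externalLanguageWithPredicate L n).Formula (Σ i, Fin (m i)) :=
    (Formula.iInf fun i => (dpSymbol (φ i)).formula fun j => Term.var ⟨i, j⟩).imp
      (((predSymbol L n).formula (fun k => Term.var (Sum.inr k)) ⊓
        Formula.iInf fun i => ((toExternal L n).onFormula (φ i)).relabel
          (Sum.elim Sum.inr fun j => Sum.inl ⟨i, j⟩)).iExs (Fin n))
  have hχ : ∀ {X : Type w} [L.Structure X] [(externalLanguageWithPredicate L n).Structure X]
      [(toExternal L n).IsExpansionOn X] (c : (Σ i, Fin (m i)) → X), χ.Realize c ↔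
      ((∀ i, Structure.RelMap (dpSymbol (φ i)) fun j => c ⟨i, j⟩) →
        ∃ a : Fin n → X, Structure.RelMap (predSymbol L n) a ∧
          ∀ i, (φ i).Realize (Sum.elim a fun j => c ⟨i, j⟩)) := by
    intro X _ _ _ c
    simp only [χ, Formula.realize_imp, Formula.realize_iInf, Formula.realize_rel,
      Formula.realize_iExs, Formula.realize_inf, Formula.realize_relabel, LHom.realize_onFormula,
      Term.realize_var, Sum.comp_elim, Sum.elim_inr]
    rfl
  have := h.forall_realize χ (fun c => (hχ c).2 (hN ι m φ fun i j => c ⟨i, j⟩)) fun z => b z.1 z.2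
  exact (hχ _).1 this hb

/-- Every formula or its negation belongs to the type, for an arbitrary structure. -/
theorem dpSymbol_total_of_equiv {N N' : Type w}
    [(externalLanguageWithPredicate L n).Structure N]
    [(externalLanguageWithPredicate L n).Structure N']
    (h : N ≅[externalLanguageWithPredicate L n] N') {m : ℕ} (φ : L.Formula (Fin n ⊕ Fin m))
    (hN : ∀ b : Fin m → N, Structure.RelMap (dpSymbol φ) b ∨ Structure.RelMap (dpSymbol φ.not) b)
    (b : Fin m → N') :
    Structure.RelMap (dpSymbol φ) b ∨ Structure.RelMap (dpSymbol φ.not) b := by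
  have := h.forall_realize
    ((dpSymbol φ).formula Term.var ⊔ (dpSymbol φ.not).formula Term.var) (fun c => by
      simpa only [Formula.realize_sup, Formula.realize_rel, Term.realize_var] using hN c) b
  simpa only [Formula.realize_sup, Formula.realize_rel, Term.realize_var] using this

/-- A type is closed under conjunction, so one formula at a time suffices. The version for finite
families is the one needed after transfer, where the d-relations are not known to come from a type.
-/
theorem TypeOver.FinitelySatisfiableIn.inPred {M : Type w} [L.Structure M] {p : TypeOver L M n}
    {A : Set (Fin n → M)} (hp : p.FinitelySatisfiableIn A) :
    letI := externalStructure p A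
    FinitelySatisfiableInPred L n M := by
  classical
  intro ι _ m φ b hb
  have := Fintype.ofFinite ι
  have key : ∀ t : Finset ι, ∃ (k : ℕ) (χ : L.Formula (Fin n ⊕ Fin k)) (d : Fin k → M),
      p.Has χ d ∧ ∀ a : Fin n → M, χ.Realize (Sum.elim a d) →
        ∀ i ∈ t, (φ i).Realize (Sum.elim a (b i)) := by
    intro t
    induction t using Finset.induction_on with
    | empty => exact ⟨0, ⊤, Fin.elim0, p.has_top _, fun a _ i hi => by simp at hi⟩
    | insert i t _ ih =>
      obtain ⟨k, χ, d, hd, hχ⟩ := ih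
      obtain ⟨χ', d', hd', hχ'⟩ := p.exists_has_inf (hb i) hd
      refine ⟨_, χ', d', hd', fun a ha i' hi' => ?_⟩
      rw [hχ'] at ha
      rcases Finset.mem_insert.1 hi' with rfl | hi'
      · exact ha.1
      · exact hχ a ha.2 i' hi'
  obtain ⟨k, χ, d, hd, hχ⟩ := key Finset.univ
  obtain ⟨a, ha, har⟩ := hp k χ d hd
  exact ⟨a, ha, fun i => hχ a har i (Finset.mem_univ i)⟩

end External

/-! ### Both predicates at once, and the automorphism -/

section TwoPredicates

variable {n : ℕ}

/-- `L_p` with two predicates. -/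
abbrev twoPredicateLanguage (L : Language.{u, v}) (n : ℕ) :=
  (externalLanguageWithPredicate L n).sum (predicateLanguage n)

/-- The predicate of `(M_p, A)` is the first of the two predicates. -/
def firstPred (L : Language.{u, v}) (n : ℕ) :
    externalLanguageWithPredicate L n →ᴸ twoPredicateLanguage L n :=
  LHom.sumInl

/-- The predicate of `(M_p, A)` is the second of the two predicates. -/
def secondPred (L : Language.{u, v}) (n : ℕ) :
    externalLanguageWithPredicate L n →ᴸ twoPredicateLanguage L n :=
  (LHom.sumInl.comp LHom.sumInl).sumElim LHom.sumInr

/-- For given finite sets, separability is an instance of one sentence mentioning both predicates;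
this is why A₁ and A₂ must live in a common structure. -/
theorem separated_of_equiv {N N' : Type w} [L.Structure N] [L.Structure N']
    [(twoPredicateLanguage L n).Structure N] [(twoPredicateLanguage L n).Structure N']
    [((firstPred L n).comp (toExternal L n)).IsExpansionOn N]
    [((firstPred L n).comp (toExternal L n)).IsExpansionOn N']
    (h : N ≅[twoPredicateLanguage L n] N') {m : ℕ} (φ : L.Formula (Fin n ⊕ Fin m))
    (P₁ P₂ : (twoPredicateLanguage L n).Relations n)
    (hN : ∀ s₁ s₂ : Set (Fin n → N), s₁.Finite → s₂.Finite → (∀ a ∈ s₁, Structure.RelMap P₁ a) →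
      (∀ a ∈ s₂, Structure.RelMap P₂ a) → ∃ c : Fin m → N, (∀ a ∈ s₁, φ.Realize (Sum.elim a c)) ∧
        ∀ a ∈ s₂, ¬ φ.Realize (Sum.elim a c))
    (s₁ s₂ : Set (Fin n → N')) (hs₁ : s₁.Finite) (hs₂ : s₂.Finite)
    (h₁ : ∀ a ∈ s₁, Structure.RelMap P₁ a) (h₂ : ∀ a ∈ s₂, Structure.RelMap P₂ a) :
    ∃ c : Fin m → N', (∀ a ∈ s₁, φ.Realize (Sum.elim a c)) ∧
      ∀ a ∈ s₂, ¬ φ.Realize (Sum.elim a c) := by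
  have := hs₁.to_subtype
  have := hs₂.to_subtype
  let ρ := (firstPred L n).comp (toExternal L n)
  let χ : (twoPredicateLanguage L n).Formula ((s₁ × Fin n) ⊕ (s₂ × Fin n)) :=
    ((Formula.iInf fun a : s₁ => P₁.formula fun k => Term.var (Sum.inl (a, k))) ⊓
      Formula.iInf fun a : s₂ => P₂.formula fun k => Term.var (Sum.inr (a, k))).imp
      (((Formula.iInf fun a : s₁ => (ρ.onFormula φ).relabel
          (Sum.map (fun k => Sum.inl (a, k)) id)) ⊓
        Formula.iInf fun a : s₂ => ((ρ.onFormula φ).relabel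
          (Sum.map (fun k => Sum.inr (a, k)) id)).not).iExs (Fin m))
  have hχ : ∀ {X : Type w} [L.Structure X] [(twoPredicateLanguage L n).Structure X]
      [ρ.IsExpansionOn X] (d : (s₁ × Fin n) ⊕ (s₂ × Fin n) → X), χ.Realize d ↔
      ((∀ a : s₁, Structure.RelMap P₁ fun k => d (Sum.inl (a, k))) ∧
        (∀ a : s₂, Structure.RelMap P₂ fun k => d (Sum.inr (a, k))) →
        ∃ c : Fin m → X, (∀ a : s₁, φ.Realize (Sum.elim (fun k => d (Sum.inl (a, k))) c)) ∧
          ∀ a : s₂, ¬ φ.Realize (Sum.elim (fun k => d (Sum.inr (a, k))) c)) := by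
    intro X _ _ _ d
    simp only [χ, Formula.realize_imp, Formula.realize_iInf, Formula.realize_rel,
      Formula.realize_iExs, Formula.realize_inf, Formula.realize_relabel, LHom.realize_onFormula,
      Term.realize_var, Sum.elim_comp_map, Formula.realize_not, Function.comp_id]
    rfl
  have key := h.forall_realize χ (fun d => (hχ d).2 fun hd => ?_)
    (Sum.elim (fun z => z.1.1 z.2) fun z => z.1.1 z.2)
  · rw [hχ] at key
    obtain ⟨c, hc₁, hc₂⟩ := key ⟨fun a => h₁ a a.2, fun a => h₂ a a.2⟩
    exact ⟨c, fun a ha => hc₁ ⟨a, ha⟩, fun a ha => hc₂ ⟨a, ha⟩⟩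
  -- The tuples listed by d may coincide in N, so the finite sets used are ranges.
  · obtain ⟨c, hc₁, hc₂⟩ := hN (Set.range fun a k => d (Sum.inl (a, k)))
      (Set.range fun a k => d (Sum.inr (a, k))) (Set.finite_range _) (Set.finite_range _)
      (Set.forall_mem_range.2 hd.1) (Set.forall_mem_range.2 hd.2)
    exact ⟨c, fun a => hc₁ _ ⟨a, rfl⟩, fun a => hc₂ _ ⟨a, rfl⟩⟩

/-- Finite satisfiability in the predicate is a first-order scheme, and (M_p,A₁), (M_p,A₂) have the
same theory. -/
theorem IsSPExample.finitelySatisfiable_right {M : Type w} [L.Structure M] {m : ℕ} {p : TypeOver L M n}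
    {φ : L.Formula (Fin n ⊕ Fin m)} {A₁ A₂ : Set (Fin n → M)} (h : IsSPExample M p φ A₁ A₂) :
    p.FinitelySatisfiableIn A₂ := by
  intro k ψ b hb
  have h1 := h.finitelySatisfiable.inPred
  have e₁ : @LHom.IsExpansionOn _ _ (toExternal L n) M _ (externalStructure p A₁) :=
    @LHom.IsExpansionOn.mk _ _ _ _ _ (externalStructure p A₁) (fun _ _ => rfl) (fun _ _ => rfl)
  have e₂ : @LHom.IsExpansionOn _ _ (toExternal L n) M _ (externalStructure p A₂) :=
    @LHom.IsExpansionOn.mk _ _ _ _ _ (externalStructure p A₂) (fun _ _ => rfl) (fun _ _ => rfl)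
  have h2 := @FinitelySatisfiableInPred.of_equiv L n M M _ _ (externalStructure p A₁)
    (externalStructure p A₂) e₁ e₂ h.theory_eq h1
  obtain ⟨a, ha, har⟩ := h2 PUnit (fun _ => k) (fun _ => ψ) (fun _ => b) (fun _ => hb)
  exact ⟨a, ha, har PUnit.unit⟩

/-- In a finite M one c would separate all of A₁ from all of A₂. But whichever of φ(x,c), ¬φ(x,c)
lies in p is satisfied both in A₁ and in A₂. -/
theorem IsSPExample.infinite {M : Type w} [L.Structure M] {m : ℕ} {p : TypeOver L M n}
    {φ : L.Formula (Fin n ⊕ Fin m)} {A₁ A₂ : Set (Fin n → M)} (h : IsSPExample M p φ A₁ A₂) :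
    Infinite M := by
  by_contra hM
  rw [not_infinite_iff_finite] at hM
  obtain ⟨c, hc₁, hc₂⟩ := h.separated A₁ A₂ A₁.toFinite A₂.toFinite le_rfl le_rfl
  by_cases hp : p.Has φ c
  · obtain ⟨a, ha, har⟩ := h.finitelySatisfiable_right m φ c hp
    exact hc₂ a ha har
  · rw [← p.has_not] at hp
    obtain ⟨a, ha, har⟩ := h.finitelySatisfiable m _ c hp
    exact har (hc₁ a ha)

/-- D comes from the two reducts of (M_p,A₁,A₂). Q and B₁, B₂ interpret the d-relations and the two
predicates; the listed properties are those that transfer as sentences or express that s is an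
isomorphism of the reducts. -/
theorem IsSPExample.exists_automorphism {M : Type w} [L.Structure M] {m : ℕ} {p : TypeOver L M n}
    {φ : L.Formula (Fin n ⊕ Fin m)} {A₁ A₂ : Set (Fin n → M)} (h : IsSPExample M p φ A₁ A₂)
    (μ : Cardinal.{w}) (hμ : ℵ₀ ≤ μ)
    (hL : Cardinal.lift.{w} (max ℵ₀ L.card) ≤ Cardinal.lift.{max u v} μ) :
    ∃ (D : Type w) (_ : L.Structure D) (s : D ≃ D)
      (Q : ∀ k, L.Formula (Fin n ⊕ Fin k) → Set (Fin k → D)) (B₁ B₂ : Set (Fin n → D)),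
      #D ≤ μ ∧ (M ≅[L] D) ∧
      (∀ (l : ℕ) (ψ : L.Formula (Fin l)) (a : Fin l → D), ψ.Realize a ↔ ψ.Realize (s ∘ a)) ∧
      (∀ k ψ b, b ∈ Q k ψ ↔ s ∘ b ∈ Q k ψ) ∧ (∀ a, a ∈ B₁ ↔ s ∘ a ∈ B₂) ∧
      (∀ k ψ b, b ∈ Q k ψ ∨ b ∈ Q k ψ.not) ∧
      (∀ (ι : Type w) [Finite ι] (k : ι → ℕ) (ψ : ∀ i, L.Formula (Fin n ⊕ Fin (k i)))
        (b : ∀ i, Fin (k i) → D), (∀ i, b i ∈ Q (k i) (ψ i)) →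
        ∃ a ∈ B₁, ∀ i, (ψ i).Realize (Sum.elim a (b i))) ∧
      ∀ s₁ s₂ : Set (Fin n → D), s₁.Finite → s₂.Finite → s₁ ⊆ B₁ → s₂ ⊆ B₂ →
        ∃ c : Fin m → D, (∀ a ∈ s₁, φ.Realize (Sum.elim a c)) ∧
          ∀ a ∈ s₂, ¬ φ.Realize (Sum.elim a c) := by
  have := h.infinite
  let i₁ := externalStructure p A₁
  let j := predicateStructure A₂
  let iK : (twoPredicateLanguage L n).Structure M := inferInstance
  let i₂ := externalStructure p A₂
  have eL : ((firstPred L n).comp (toExternal L n)).IsExpansionOn M :=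
    ⟨fun _ _ => rfl, fun _ _ => rfl⟩
  have e₁ : @LHom.IsExpansionOn _ _ (firstPred L n) M i₁ iK :=
    @LHom.IsExpansionOn.mk _ _ _ _ i₁ iK (fun _ _ => rfl) (fun _ _ => rfl)
  have e₂ : @LHom.IsExpansionOn _ _ (secondPred L n) M i₂ iK :=
    @LHom.IsExpansionOn.mk _ _ _ _ i₂ iK
      (fun {k} f x => by rcases f with f | f <;> rfl)
      (fun {k} R x => by rcases R with R | R <;> rfl)
  have hred : ∀ ψ : (externalLanguageWithPredicate L n).Sentence,
      M ⊨ (firstPred L n).onSentence ψ ↔ M ⊨ (secondPred L n).onSentence ψ := by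
    intro ψ
    have h1 := @LHom.realize_onSentence _ _ M i₁ iK (firstPred L n) e₁ ψ
    have h2 := @LHom.realize_onSentence _ _ M i₂ iK (secondPred L n) e₂ ψ
    rw [h1, h2]
    exact @ElementarilyEquivalent.realize_sentence _ M M i₁ i₂ h.theory_eq ψ
  have hK : Cardinal.lift.{w} (twoPredicateLanguage L n).card ≤ Cardinal.lift.{max u v} μ :=
    (lift_le.2 (card_externalLanguageWithPredicate_sum_le L n)).trans hL
  obtain ⟨D, sK, s, hD, hMD, hs⟩ :=
    exists_equiv_of_reducts (firstPred L n) (secondPred L n) M μ hμ hK hred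
  let sL : L.Structure D := ((firstPred L n).comp (toExternal L n)).reduct D
  let s₁ : (externalLanguageWithPredicate L n).Structure D := (firstPred L n).reduct D
  have eD : (toExternal L n).IsExpansionOn D := ⟨fun _ _ => rfl, fun _ _ => rfl⟩
  have eM : @LHom.IsExpansionOn _ _ (toExternal L n) M _ i₁ :=
    @LHom.IsExpansionOn.mk _ _ _ _ _ i₁ (fun _ _ => rfl) (fun _ _ => rfl)
  have hMD' : @ElementarilyEquivalent (externalLanguageWithPredicate L n) M D i₁ s₁ :=
    @ElementarilyEquivalent.of_isExpansionOn _ _ (firstPred L n) M D i₁ iK s₁ sK e₁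
      (LHom.isExpansionOn_reduct _ D) hMD
  have hMD'' : M ≅[L] D :=
    @ElementarilyEquivalent.of_isExpansionOn _ _ (toExternal L n) M D _ i₁ sL s₁ eM eD hMD'
  refine ⟨D, sL, s, fun k ψ => {b | Structure.RelMap (dpSymbol ψ) b},
    {a | Structure.RelMap (predSymbol L n) a},
    {a | Structure.RelMap ((secondPred L n).onRelation (predSymbol L n)) a}, hD, hMD'',
    ?_, ?_, ?_, ?_, ?_, ?_⟩
  · intro l ψ a
    -- Both reducts induce the same L-structure on D, so on L-formulas s is an automorphism.
    have h1 := hs l ((toExternal L n).onFormula ψ) a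
    have f₁ : @LHom.IsExpansionOn _ _ (firstPred L n) D s₁ sK := LHom.isExpansionOn_reduct _ D
    rw [@LHom.realize_onFormula _ _ D s₁ _ sK (firstPred L n) f₁,
      @LHom.realize_onFormula _ _ D sL _ s₁ (toExternal L n) eD] at h1
    let s₂ : (externalLanguageWithPredicate L n).Structure D := (secondPred L n).reduct D
    have f₂ : @LHom.IsExpansionOn _ _ (secondPred L n) D s₂ sK := LHom.isExpansionOn_reduct _ D
    have f₃ : @LHom.IsExpansionOn _ _ (toExternal L n) D sL s₂ :=
      @LHom.IsExpansionOn.mk _ _ _ _ sL s₂ (fun _ _ => rfl) (fun _ _ => rfl)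
    rw [@LHom.realize_onFormula _ _ D s₂ _ sK (secondPred L n) f₂,
      @LHom.realize_onFormula _ _ D sL _ s₂ (toExternal L n) f₃] at h1
    exact h1
  · intro k ψ b
    exact hs k ((dpSymbol ψ).formula Term.var) b
  · intro a
    exact hs n ((predSymbol L n).formula Term.var) a
  · intro k ψ b
    exact @dpSymbol_total_of_equiv L n M D i₁ s₁ hMD' k ψ
      (fun b => (em (p.Has ψ b)).imp id (p.has_not ψ b).2) b
  · exact @FinitelySatisfiableInPred.of_equiv L n M D _ sL i₁ s₁ eM eD hMD'
      h.finitelySatisfiable.inPred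
  · intro t₁ t₂ ht₁ ht₂ h₁ h₂
    have eD' : ((firstPred L n).comp (toExternal L n)).IsExpansionOn D :=
      ⟨fun _ _ => rfl, fun _ _ => rfl⟩
    exact separated_of_equiv hMD φ ((firstPred L n).onRelation (predSymbol L n))
      ((secondPred L n).onRelation (predSymbol L n))
      (fun s₁ s₂ hs₁ hs₂ h₁ h₂ => h.separated s₁ s₂ hs₁ hs₂ h₁ h₂) t₁ t₂ ht₁ ht₂ h₁ h₂

end TwoPredicates

/-! ### From an sp-example to splintering -/

theorem ElementaryEmbedding.exists_range_eq {D C : Type w} [L.Structure D] [L.Structure C]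
    (j : D ↪ₑ[L] C) : ∃ M : L.ElementarySubstructure C, ∀ z, z ∈ M ↔ ∃ d, j d = z := by
  have hmem : ∀ z, z ∈ j.toHom.range ↔ ∃ d, j d = z := fun z => Hom.mem_range
  refine ⟨⟨j.toHom.range, fun l φ x => ?_⟩, hmem⟩
  let e : D ≃[L] j.toHom.range := j.toEmbedding.equivRange
  have h1 : x = e ∘ (e.symm ∘ x) := funext fun i => (e.apply_symm_apply (x i)).symm
  have h2 : (Subtype.val ∘ x : Fin l → C) = j ∘ (e.symm ∘ x) := by
    conv_lhs => rw [h1]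
    rfl
  rw [h2, j.map_formula]
  conv_rhs => rw [h1]
  exact (StrongHomClass.realize_formula e φ).symm

/-- `hQ` says that the sets prescribed by Q, together with B, have the finite intersection property.
-/
theorem exists_ultrafilter {D : Type w} [L.Structure D] {n : ℕ}
    (Q : ∀ k, L.Formula (Fin n ⊕ Fin k) → Set (Fin k → D)) (B : Set (Fin n → D))
    (hQ : ∀ (ι : Type w) [Finite ι] (k : ι → ℕ) (ψ : ∀ i, L.Formula (Fin n ⊕ Fin (k i)))
        (b : ∀ i, Fin (k i) → D), (∀ i, b i ∈ Q (k i) (ψ i)) →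
        ∃ a ∈ B, ∀ i, (ψ i).Realize (Sum.elim a (b i))) :
    ∃ U : Ultrafilter (Fin n → D), B ∈ U ∧ ∀ k ψ b, b ∈ Q k ψ →
      ∀ᶠ a : Fin n → D in (U : Filter (Fin n → D)), ψ.Realize (Sum.elim a b) := by
  let S : Set (Set (Fin n → D)) := {s | ∃ k ψ, ∃ b ∈ Q k ψ, s = {a | ψ.Realize (Sum.elim a b)}}
  have hne : (Filter.generate S ⊓ Filter.principal B).NeBot := by
    rw [← Filter.generate_singleton, ← Filter.generate_union, Filter.generate_neBot_iff]
    intro t ht htf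
    have := (htf.inter_of_left S).to_subtype
    have hc : ∀ s : ↥(t ∩ S), ∃ k ψ, ∃ b ∈ Q k ψ, (s : Set _) = {a | ψ.Realize (Sum.elim a b)} :=
      fun s => s.2.2
    choose k ψ b hb hs using hc
    obtain ⟨a, ha, har⟩ := hQ _ k ψ b hb
    refine ⟨a, fun s hst => ?_⟩
    rcases ht hst with hS | rfl
    · exact (hs ⟨s, hst, hS⟩).ge (har ⟨s, hst, hS⟩)
    · exact ha
  have hle := Ultrafilter.of_le (Filter.generate S ⊓ Filter.principal B)
  refine ⟨Ultrafilter.of _, hle (Filter.mem_inf_of_right (Filter.mem_principal_self B)),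
    fun k ψ b hb => hle (Filter.mem_inf_of_left (Filter.mem_generate_of_mem ⟨k, ψ, b, hb, rfl⟩))⟩

theorem IsMonster.exists_separating {C : Type w} [L.Structure C] {κ : Cardinal.{w}}
    (hC : L.IsMonster C κ) {D : Type w} (hD : #D < κ) (j : D → C) {n m : ℕ}
    (φ : L.Formula (Fin n ⊕ Fin m)) (B₁ B₂ : Set (Fin n → D))
    (h : ∀ s₁ s₂ : Set (Fin n → D), s₁.Finite → s₂.Finite → s₁ ⊆ B₁ → s₂ ⊆ B₂ →
        ∃ c : Fin m → C, (∀ a ∈ s₁, φ.Realize (Sum.elim (j ∘ a) c)) ∧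
          ∀ a ∈ s₂, ¬ φ.Realize (Sum.elim (j ∘ a) c)) :
    ∃ c : Fin m → C, (∀ a ∈ B₁, φ.Realize (Sum.elim (j ∘ a) c)) ∧
      ∀ a ∈ B₂, ¬ φ.Realize (Sum.elim (j ∘ a) c) := by
  classical
  let F : (Fin n → D) ⊕ (Fin n → D) → L.Formula (D ⊕ Fin m) :=
    Sum.elim (fun a => φ.relabel (Sum.map a id)) fun a => (φ.relabel (Sum.map a id)).not
  have hF₁ : ∀ a (c : Fin m → C), (F (Sum.inl a)).Realize (Sum.elim j c) ↔
      φ.Realize (Sum.elim (j ∘ a) c) := fun a c => by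
    simp [F, Formula.realize_relabel, Sum.elim_comp_map]
  have hF₂ : ∀ a (c : Fin m → C), (F (Sum.inr a)).Realize (Sum.elim j c) ↔
      ¬ φ.Realize (Sum.elim (j ∘ a) c) := fun a c => by
    simp [F, Formula.realize_relabel, Sum.elim_comp_map]
  let S : Set ((Fin n → D) ⊕ (Fin n → D)) := Sum.inl '' B₁ ∪ Sum.inr '' B₂
  obtain ⟨c, hc⟩ := hC.exists_realize hD j (F '' S) (by
    intro Γ₀ hΓ₀
    obtain ⟨S₀, hS₀, rfl⟩ := Finset.subset_set_image_iff.1 hΓ₀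
    obtain ⟨c, hc₁, hc₂⟩ := h {a | Sum.inl a ∈ S₀} {a | Sum.inr a ∈ S₀}
      (S₀.finite_toSet.preimage Sum.inl_injective.injOn)
      (S₀.finite_toSet.preimage Sum.inr_injective.injOn)
      (fun a ha => by simpa [S] using hS₀ ha) (fun a ha => by simpa [S] using hS₀ ha)
    refine ⟨c, fun ψ hψ => ?_⟩
    obtain ⟨a | a, ha, rfl⟩ := Finset.mem_image.1 hψ
    · exact (hF₁ a c).2 (hc₁ a ha)
    · exact (hF₂ a c).2 (hc₂ a ha))
  exact ⟨c, fun a ha => (hF₁ a c).1 (hc _ ⟨_, Or.inl ⟨a, ha, rfl⟩, rfl⟩),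
    fun a ha => (hF₂ a c).1 (hc _ ⟨_, Or.inr ⟨a, ha, rfl⟩, rfl⟩)⟩

theorem exists_splinters_of_hasSPExample {T : L.Theory} (hT : T.IsComplete) {C : Type w}
    [L.Structure C] [Nonempty C] (hCT : C ⊨ T) {κ : Cardinal.{w}} (hC : L.IsMonster C κ)
    (h : HasSPExample.{u, v, w} T) :
    ∃ (M : L.ElementarySubstructure C) (n : ℕ) (p : L.TypeOver C n),
      #M < κ ∧ p.FinitelySatisfiableIn {a | ∀ i, a i ∈ M} ∧ p.Splinters M := by
  obtain ⟨M₀, n, m, p₀, φ, A₁, A₂, hsp⟩ := h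
  -- μ is |L| + ℵ₀ brought down to the universe of C, which is possible as it lies below κ.
  obtain ⟨μ, hμ⟩ := mem_range_lift_of_le hC.card_lt.le
  have hμκ : μ < κ := lift_lt.1 (hμ.trans_lt hC.card_lt)
  have hμ₀ : ℵ₀ ≤ μ := by
    rw [← aleph0_le_lift.{w, max u v}, hμ, aleph0_le_lift]
    exact le_max_left _ _
  obtain ⟨D, _, s, Q, B₁, B₂, hDμ, hMD, hs, hsQ, hsB, htot, hfip, hsep⟩ :=
    hsp.exists_automorphism μ hμ₀ hμ.ge
  have hD := hDμ.trans_lt hμκ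
  have hMC : M₀ ≅[L] C := hT.models_elementarily_equivalent M₀ C
  obtain ⟨j⟩ := hC.nonempty_elementaryEmbedding hD (hMD.symm.trans hMC)
  obtain ⟨σ, hσ⟩ := hC.exists_extend hD j s hs
  have hσ' : ∀ d, σ.symm (j d) = j (s.symm d) := fun d => by
    rw [← σ.injective.eq_iff, σ.apply_symm_apply, hσ, s.apply_symm_apply]
  obtain ⟨U, hBU, hU⟩ := exists_ultrafilter Q B₁ hfip
  obtain ⟨M, hM⟩ := j.exists_range_eq
  -- The ultrafilter lives on tuples of D, but its image under j is averaged over all parameters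
  -- from C, which gives a global type.
  let q : L.TypeOver C n := TypeOver.ofUltrafilter (U.map (j ∘ ·))
  have hq : ∀ {k} (ψ : L.Formula (Fin n ⊕ Fin k)) (c : Fin k → C), q.Has ψ c ↔
      ∀ᶠ a : Fin n → D in (U : Filter (Fin n → D)), ψ.Realize (Sum.elim (j ∘ a) c) :=
    fun ψ c => TypeOver.has_ofUltrafilter _ ψ c
  have hqQ' : ∀ {k} (ψ : L.Formula (Fin n ⊕ Fin k)) (b : Fin k → D), b ∈ Q k ψ →
      q.Has ψ (j ∘ b) := fun ψ b hb => by
    rw [hq]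
    refine (hU _ ψ b hb).mono fun a ha => ?_
    rwa [← Sum.comp_elim, j.map_formula]
  have hqQ : ∀ {k} (ψ : L.Formula (Fin n ⊕ Fin k)) (b : Fin k → D),
      q.Has ψ (j ∘ b) ↔ b ∈ Q k ψ := fun ψ b => by
    -- Q decides every formula, so the restriction of q to D is exactly Q.
    refine ⟨fun hb => (htot _ ψ b).resolve_right fun hn => ?_, hqQ' ψ b⟩
    exact (q.has_not ψ _).1 (hqQ' _ b hn) hb
  have hcard : #M < κ := by
    refine lt_of_le_of_lt ?_ hD
    refine mk_le_of_surjective (f := fun d => (⟨j d, (hM _).2 ⟨d, rfl⟩⟩ : M)) fun z => ?_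
    obtain ⟨d, hd⟩ := (hM z).1 z.2
    exact ⟨d, Subtype.ext hd⟩
  obtain ⟨c, hc₁, hc₂⟩ := hC.exists_separating hD j φ B₁ B₂ fun s₁ s₂ hs₁ hs₂ h₁ h₂ => by
    obtain ⟨d, hd₁, hd₂⟩ := hsep s₁ s₂ hs₁ hs₂ h₁ h₂
    refine ⟨j ∘ d, fun a ha => ?_, fun a ha => ?_⟩ <;> rw [← Sum.comp_elim, j.map_formula]
    exacts [hd₁ a ha, hd₂ a ha]
  refine ⟨M, n, q, hcard, ?_, σ, fun heq => ?_, ?_, ?_⟩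
  · intro k ψ b hb
    obtain ⟨a, ha⟩ := ((hq ψ b).1 hb).exists
    exact ⟨j ∘ a, fun i => (hM _).2 ⟨a i, rfl⟩, ha⟩
  -- If σ(q) = q, then φ(a,σ⁻¹c) holds for some a ∈ B₁. Applying σ gives φ(s(a),c) with s(a) ∈ B₂,
  -- contrary to the choice of c.
  · have h1 : q.Has φ c := (hq φ c).2 (Filter.mem_of_superset hBU hc₁)
    rw [← heq, TypeOver.has_conj, hq] at h1
    obtain ⟨a, ha, haB⟩ := (h1.and hBU).exists
    refine hc₂ (s ∘ a) ((hsB a).1 haB) ?_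
    rw [← StrongHomClass.realize_formula σ, Sum.comp_elim] at ha
    have e1 : σ ∘ (j ∘ a) = j ∘ (s ∘ a) := funext fun i => hσ (a i)
    have e2 : σ ∘ (σ.symm ∘ c) = c := funext fun i => σ.apply_symm_apply (c i)
    rwa [e1, e2] at ha
  · refine TypeOver.ext_has fun k ψ b => ?_
    rw [TypeOver.has_restrict, TypeOver.has_restrict, TypeOver.has_conj]
    choose b' hb' using fun i => (hM (b i)).1 (b i).2
    have e1 : (Subtype.val ∘ b : Fin k → C) = j ∘ b' := funext fun i => (hb' i).symm
    have e2 : σ.symm ∘ (j ∘ b') = j ∘ (s.symm ∘ b') := funext fun i => hσ' (b' i)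
    have e3 : s ∘ (s.symm ∘ b') = b' := funext fun i => s.apply_symm_apply (b' i)
    rw [e1, e2, hqQ, hqQ, hsQ, e3]
  · ext z
    rw [Set.mem_image, SetLike.mem_coe, hM]
    constructor
    · rintro ⟨_, hy, rfl⟩
      obtain ⟨d, rfl⟩ := (hM _).1 hy
      exact ⟨s d, (hσ d).symm⟩
    · rintro ⟨d, rfl⟩
      exact ⟨j (s.symm d), (hM _).2 ⟨_, rfl⟩, by rw [hσ, s.apply_symm_apply]⟩

end FirstOrder.Language

theorem mainTheorem8 {L : FirstOrder.Language.{u, v}} (T : L.Theory)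
    (hT : T.IsComplete) (C : Type w) [L.Structure C] [Nonempty C] (hCT : C ⊨ T)
    (κ : Cardinal.{w}) (hC : L.IsMonster C κ) :
    (FirstOrder.Language.HasSPExample.{u, v, w} T ↔
      ∃ (M : L.ElementarySubstructure C) (n : ℕ) (p : L.TypeOver C n),
        Cardinal.mk M < κ ∧
        p.FinitelySatisfiableIn {a : Fin n → C | ∀ i, a i ∈ M} ∧
        p.Splinters M) ∧
    (FirstOrder.Language.HasSPExample.{u, v, w} T →
      ∃ (M : L.ElementarySubstructure C) (n : ℕ) (p : L.TypeOver C n),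
        Cardinal.mk M < κ ∧ p.Splinters M ∧ ¬ p.Splits M) := by
  have h := FirstOrder.Language.exists_splinters_of_hasSPExample hT hCT hC
  refine ⟨⟨h, ?_⟩, fun hsp => ?_⟩
  · rintro ⟨M, n, p, -, hp, hs⟩
    exact FirstOrder.Language.hasSPExample_of_splinters hCT hp hs
  · obtain ⟨M, n, p, hM, hp, hs⟩ := h hsp
    exact ⟨M, n, p, hM, hs, FirstOrder.Language.TypeOver.not_splits_of_finitelySatisfiableIn hp⟩
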